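/- Let $M$ be a connected smooth Riemannian manifold of dimension $d$, with geodesic distance and Riemannian volume measure $\mathrm{vol}$. Let $f_0,f_1,\dots,f_m$ be $C^2$ vector fields on $M$, let $U\subset\mathbb R^m$ be an infinite compact convex set, and let $\mathcal U$ be the set of measurable functions $u:\mathbb R\to\mathbb R^m$ with $u(t)\in U$ for a.e. $t$, with the weak* topology of $L^\infty(\mathbb R,\mathbb R^m)=L^1(\mathbb R,\mathbb R^m)^*$ and the shifts $\theta_s u=u(\cdot+s)$. Consider the control-affine system $$\dot x(t)=f_0(x(t))+\sum_{i=1}^m u_i(t)f_i(x(t)),\qquad u\in\mathcal U,$$ whose solutions are understood in the sense of Carathéodory, and assume that all of them are defined on $\mathbb R$; write $\varphi(t,x,u)$ for the trajectory with $\varphi(0,x,u)=x$. Let $Q\subset M$ be compact, and for $u\in\mathcal U$ let $Q(u)=\{x\in M:\varphi(\mathbb R,x,u)\subset Q\}$. Assume (P3) the set-valued map $u\mapsto Q(u)$ on $\mathcal U$ is lower semicontinuous, i.e. for every open $O\subset M$ the set $\{u\in\mathcal U: Q(u)\cap O\neq\emptyset\}$ is open. For $t>0$, $u\in\mathcal U$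 and $\varepsilon>0$ put $$Q(t,u,\varepsilon)=\{x\in M:\operatorname{dist}(\varphi(s,x,u),Q(\theta_su))\le\varepsilon\text{ for all }s\in[0,t]\},$$ where $\operatorname{dist}(x,\emptyset)=\infty$. For $K\subset Q$ and $\tau>0$, a set $\mathcal S\subset\mathcal U$ is $(\tau,K,Q)$-spanning if for every $x\in K$ there is $u\in\mathcal S$ with $\varphi([0,\tau],x,u)\subset Q$; let $r_{\rm inv}(\tau,K,Q)\in\mathbb N\cup\{\infty\}$ be the smallest cardinality of such a set, and $$h_{\rm inv}(K,Q)=\limsup_{\tau\to\infty}\frac1\tau\log r_{\rm inv}(\tau,K,Q)\in[0,\infty].$$ Then for every compact set $K\subset Q$ with $\mathrm{vol}(K)>0$ such that every $x\in K$ admits some $u\in\mathcal U$ with $\varphi([0,\infty),x,u)\subset Q$, and for every $\varepsilon>0$, $$h_{\rm inv}(K,Q)\ \ge\ \limsup_{t\to\infty}\ \inf_{u\in\mathcal U}\ -\frac1t\log\mathrm{vol}\bigl(Q(t,u,\varepsilon)\bigr),$$ as an inequality in $[-\infty,\infty]$ with $\log 0=-\infty$ and $\log\infty=\infty$. -/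

import Mathlib

open MeasureTheory Filter Set
open scoped Bundle Manifold ContDiff ENNReal Topology

noncomputable section

namespace InvarianceEntropy

/-! ### Admissible control functions -/

/-- The set of admissible controls: measurable functions `u : ℝ → ℝᵐ` with `u t ∈ U` for almost
every `t`. -/
structure Control {m : ℕ} (U : Set (EuclideanSpace ℝ (Fin m))) where
  /-- The underlying function. -/
  toFun : ℝ → EuclideanSpace ℝ (Fin m)
  measurable_toFun : Measurable toFun
  ae_mem : ∀ᵐ t, toFun t ∈ U

/-- The weak* topology of `L^∞(ℝ, ℝᵐ) = L¹(ℝ, ℝᵐ)*` on the controls: the coarsest topology for which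
`u ↦ ∫ ⟨u t, g t⟩ dt` is continuous for every integrable `g : ℝ → ℝᵐ`. Controls that agree almost
everywhere are topologically indistinguishable; they also have the same trajectories. -/
instance Control.instTopologicalSpace {m : ℕ} (U : Set (EuclideanSpace ℝ (Fin m))) :
    TopologicalSpace (Control U) :=
  ⨅ g : {g : ℝ → EuclideanSpace ℝ (Fin m) // Integrable g},
    TopologicalSpace.induced (fun u : Control U => ∫ t, inner ℝ (u.toFun t) (g.1 t)) inferInstance

/-- The shift `θ_s u = u(· + s)`. -/
def Control.shift {m : ℕ} {U : Set (EuclideanSpace ℝ (Fin m))} (s : ℝ) (u : Control U) :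
    Control U where
  toFun t := u.toFun (t + s)
  measurable_toFun := u.measurable_toFun.comp (measurable_add_const s)
  ae_mem := (measurePreserving_add_right volume s).quasiMeasurePreserving.ae u.ae_mem

/-! ### The Riemannian volume measure -/

section Volume

variable (d : ℕ) {M : Type*} [TopologicalSpace M] [ChartedSpace (EuclideanSpace ℝ (Fin d)) M]
  [Bundle.RiemannianBundle (fun x : M => TangentSpace (𝓡 d) x)]

/-- The Gram matrix `(g_{ij}(y))` of the Riemannian metric in the preferred chart at `p`, at the
point `y` of the chart's target: `g_{ij} = ⟨∂_i, ∂_j⟩` with `∂_i` the coordinate vector fields. -/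
def chartGram (p : M) (y : EuclideanSpace ℝ (Fin d)) : Matrix (Fin d) (Fin d) ℝ :=
  Matrix.of fun i j =>
    let ψ := (chartAt (EuclideanSpace ℝ (Fin d)) p).symm
    let e : Fin d → TangentSpace (𝓡 d) y := fun i => EuclideanSpace.single i (1 : ℝ)
    inner ℝ (mfderiv (𝓡 d) (𝓡 d) ψ y (e i)) (mfderiv (𝓡 d) (𝓡 d) ψ y (e j))

/-- The Riemannian volume on the domain of the preferred chart at `p`, as a measure on `M`
(vanishing outside that domain): Lebesgue measure on the chart's target with density
`√(det g_{ij})`, transported to `M`. -/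
def chartVolume [MeasurableSpace M] (p : M) : Measure M :=
  ((volume.restrict (chartAt (EuclideanSpace ℝ (Fin d)) p).target).withDensity
    fun y => ENNReal.ofReal (Real.sqrt (chartGram d p y).det)).map
      (chartAt (EuclideanSpace ℝ (Fin d)) p).symm

/-- The Riemannian volume measure `vol`, glued from the measures `√(det g_{ij}) dy¹ ⋯ dyᵈ` on the
chart domains. As these agree on overlaps, the gluing is their supremum in the complete lattice of
measures on `M`, i.e. the smallest measure that dominates all of them. -/
def riemannianVolume (M : Type*) [TopologicalSpace M]
    [ChartedSpace (EuclideanSpace ℝ (Fin d)) M]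
    [Bundle.RiemannianBundle (fun x : M => TangentSpace (𝓡 d) x)] [MeasurableSpace M] : Measure M :=
  ⨆ p : M, chartVolume d p

end Volume

/-! ### Trajectories of the control-affine system -/

section System

variable {d m : ℕ} {M : Type*} [MetricSpace M] [ChartedSpace (EuclideanSpace ℝ (Fin d)) M]
  (f₀ : (x : M) → TangentSpace (𝓡 d) x) (f : Fin m → (x : M) → TangentSpace (𝓡 d) x)
  {U : Set (EuclideanSpace ℝ (Fin m))}

/-- `γ : ℝ → M` is a (Carathéodory) solution on all of `ℝ` of
`ẋ(t) = f₀(x(t)) + ∑ᵢ uᵢ(t) fᵢ(x(t))`: it is locally absolutely continuous and satisfies the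
equation at almost every time. -/
def IsTrajectory (u : Control U) (γ : ℝ → M) : Prop :=
  (∀ a b : ℝ, AbsolutelyContinuousOnInterval γ a b) ∧
  ∀ᵐ t : ℝ, HasMFDerivAt 𝓘(ℝ, ℝ) (𝓡 d) γ t
    ((1 : ℝ →L[ℝ] ℝ).smulRight (f₀ (γ t) + ∑ i, u.toFun t i • f i (γ t)))

/-- All trajectories are defined on `ℝ`. -/
def IsComplete (U : Set (EuclideanSpace ℝ (Fin m))) : Prop :=
  ∀ (u : Control U) (x : M), ∃ γ : ℝ → M, IsTrajectory f₀ f u γ ∧ γ 0 = x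

open Classical in
/-- `φ(t, x, u)`: the value at time `t` of the trajectory through `x` at time `0` for the control
`u`. (The trajectory is unique for `C²` vector fields, and it exists on `ℝ` under `IsComplete`;
the value `x` in the other case is a convention.) -/
def flow (t : ℝ) (x : M) (u : Control U) : M :=
  if h : ∃ γ : ℝ → M, IsTrajectory f₀ f u γ ∧ γ 0 = x then h.choose t else x

/-- The fiber `Q(u) = {x | φ(ℝ, x, u) ⊆ Q}`. -/
def fiber (Q : Set M) (u : Control U) : Set M :=
  {x | ∀ t : ℝ, flow f₀ f t x u ∈ Q}

/-- `Q(t, u, ε) = {x | dist(φ(s, x, u), Q(θ_s u)) ≤ ε for 0 ≤ s ≤ t}`. -/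
def fiberTube (Q : Set M) (t : ℝ) (u : Control U) (ε : ℝ) : Set M :=
  {x | ∀ s ∈ Icc 0 t,
    Metric.infEDist (flow f₀ f s x u) (fiber f₀ f Q (u.shift s)) ≤ ENNReal.ofReal ε}

/-! ### Invariance entropy -/

/-- `S` is `(τ, K, Q)`-spanning. -/
def IsSpanning (τ : ℝ) (K Q : Set M) (S : Set (Control U)) : Prop :=
  ∀ x ∈ K, ∃ u ∈ S, ∀ t ∈ Icc 0 τ, flow f₀ f t x u ∈ Q

/-- `r_inv(τ, K, Q)`: the smallest cardinality of a `(τ, K, Q)`-spanning set of controls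
(`⊤` if there is no finite one). -/
def rInv (U : Set (EuclideanSpace ℝ (Fin m))) (τ : ℝ) (K Q : Set M) : ℕ∞ :=
  ⨅ (S : Set (Control U)) (_ : IsSpanning f₀ f τ K Q S), S.encard

/-- The invariance entropy `h_inv(K, Q) = limsup_{τ → ∞} (1/τ) log r_inv(τ, K, Q)`. -/
def hInv (U : Set (EuclideanSpace ℝ (Fin m))) (K Q : Set M) : EReal :=
  limsup (fun τ : ℝ => ((1 / τ : ℝ) : EReal) * ENNReal.log (rInv f₀ f U τ K Q : ℝ≥0∞)) atTop

end System

end InvarianceEntropy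

end

/-! A spanning set `S` for the time `t + 2T` covers `K` by the sets `A u` of points that `u ∈ S`
keeps in `Q` up to that time, so `vol K` is at most the cardinality of `S` times the largest `vol (A
u)`. It remains to compare `A u` with a tube around the fibers, with constants independent of `u`
and `t`.

First, for large `T` a point whose trajectory stays in `Q` on `[-T, T]` lies within `ε` of the fiber
(`exists_infEDist_fiber_le`). Otherwise counterexamples with `T → ∞` accumulate at a point of some
fiber `Q(u)`, by weak* compactness of the controls (`Control.compactSpace`) and stability of
trajectories under limits (`exists_isTrajectory_of_tendsto`); lower semicontinuity then puts points
of the approximating fibers next to them, a contradiction. Hence the time-`T` flow maps `A u` into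
`Q(t, θ_T u, ε)`.

Second, flowing back through time `T` inside `Q` expands volume by a bounded factor
(`IsEmbeddingNear.exists_riemannianVolume_le_image_flow`). Grönwall makes the backward flow
Lipschitz, which suffices for Hausdorff measure, so no derivative of the flow in the initial state
is needed.

Both facts are proved through a map `F` from `M` to a finite product of copies of `ℝᵈ × ℝ`
(`exists_isEmbeddingNear`). Through it the differential equation becomes an integral equation in a
normed space, and on `Q` distance and volume are comparable with distance and `d`-dimensional
Hausdorff measure of the image.

Together, `vol K ≤ r_inv(t + 2T, K, Q) · C · sup_u vol Q(t, u, ε)`, and the constants `2T` and `C`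
disappear in the exponential rate. -/

noncomputable section

namespace InvarianceEntropy

/-! ### Weak convergence from convergence of primitives -/

section WeakConvergence

theorem locallyIntegrable_of_ae_norm_le {H : Type*} [NormedAddCommGroup H] [MeasurableSpace H]
    [BorelSpace H] [SecondCountableTopology H] {v : ℝ → H} (hv : Measurable v) {C : ℝ}
    (hC : ∀ᵐ t, ‖v t‖ ≤ C) : LocallyIntegrable v volume :=
  ((memLp_top_of_bound hv.aestronglyMeasurable C hC).locallyIntegrable le_top)

theorem intervalIntegrable_of_ae_norm_le {H : Type*} [NormedAddCommGroup H] [MeasurableSpace H]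
    [BorelSpace H] [SecondCountableTopology H] {v : ℝ → H} (hv : Measurable v) {C : ℝ}
    (hC : ∀ᵐ t, ‖v t‖ ≤ C) (a b : ℝ) : IntervalIntegrable v volume a b :=
  intervalIntegrable_iff.2 <| (LocallyIntegrable.integrableOn_isCompact
    (locallyIntegrable_of_ae_norm_le hv hC) isCompact_uIcc).mono_set uIoc_subset_uIcc

variable {α H : Type*} [NormedAddCommGroup H] [InnerProductSpace ℝ H]

theorem integrable_inner_of_ae_norm_le [MeasurableSpace H]
    [BorelSpace H] [SecondCountableTopology H] {μ : Measure ℝ} {v g : ℝ → H} (hv : Measurable v) {C : ℝ}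
    (hC : ∀ᵐ t ∂μ, ‖v t‖ ≤ C) (hg : Integrable g μ) : Integrable (fun t => inner ℝ (v t) (g t)) μ := by
  refine (hg.norm.const_mul C).mono' (hv.aestronglyMeasurable.inner hg.aestronglyMeasurable) ?_
  filter_upwards [hC] with t ht
  exact (norm_inner_le_norm _ _).trans (mul_le_mul_of_nonneg_right ht (norm_nonneg _))

theorem abs_intervalIntegral_inner_le {v g : ℝ → H} {C c : ℝ} (hC : ∀ᵐ t, ‖v t‖ ≤ C)
    {a b : ℝ} (hg : ∀ t ∈ uIoc a b, ‖g t‖ ≤ c) :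
    |∫ t in a..b, inner ℝ (v t) (g t)| ≤ C * c * |b - a| := by
  refine intervalIntegral.norm_integral_le_of_norm_le_const_ae
    (f := fun t => inner ℝ (v t) (g t)) ?_
  filter_upwards [hC] with t ht hmem
  exact (norm_inner_le_norm _ _).trans
    (mul_le_mul ht (hg t hmem) (norm_nonneg _) ((norm_nonneg _).trans ht))

variable [CompleteSpace H] [MeasurableSpace H] [BorelSpace H] [SecondCountableTopology H]

/-- A bounded family whose primitives converge pointwise converges weakly against continuous
functions on every compact interval. -/
theorem tendsto_intervalIntegral_inner_of_continuous (l : Ultrafilter α) {v : α → ℝ → H}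
    {w : ℝ → H} {C : ℝ} (hvm : ∀ n, Measurable (v n)) (hwm : Measurable w)
    (hv : ∀ n, ∀ᵐ t, ‖v n t‖ ≤ C) (hw : ∀ᵐ t, ‖w t‖ ≤ C)
    (h : ∀ a b, Tendsto (fun n => ∫ t in a..b, v n t) l (𝓝 (∫ t in a..b, w t)))
    {g : ℝ → H} (hg : Continuous g) (a b : ℝ) :
    Tendsto (fun n => ∫ t in a..b, inner ℝ (v n t) (g t)) l
      (𝓝 (∫ t in a..b, inner ℝ (w t) (g t))) := by
  have hC0 : 0 ≤ C := by
    obtain ⟨t, ht⟩ := hw.exists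
    exact (norm_nonneg _).trans ht
  have ii : ∀ (x : ℝ → H), Measurable x → (∀ᵐ t, ‖x t‖ ≤ C) → ∀ (g : ℝ → H), Continuous g →
      ∀ c d : ℝ, IntervalIntegrable (fun t => inner ℝ (x t) (g t)) volume c d := by
    intro x hx hxC g hg c d
    rw [intervalIntegrable_iff]
    exact integrable_inner_of_ae_norm_le hx (ae_restrict_of_ae hxC) (hg.intervalIntegrable c d).def'
  have bd : ∀ n c d, |∫ t in c..d, inner ℝ (v n t) (g t)| ≤
      C * (sSup ((fun t => ‖g t‖) '' uIcc c d)) * |d - c| := by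
    intro n c d
    refine abs_intervalIntegral_inner_le (hv n) fun t ht => ?_
    exact le_csSup (isCompact_uIcc.image hg.norm).bddAbove ⟨t, uIoc_subset_uIcc ht, rfl⟩
  -- Bounded quantities converge along an ultrafilter, so only the value of the limit is in
  -- question.
  have ex : ∀ c d, ∃ L, Tendsto (fun n => ∫ t in c..d, inner ℝ (v n t) (g t)) l (𝓝 L) := by
    intro c d
    obtain ⟨L, -, hL⟩ := (isCompact_closedBall (0 : ℝ)
      (C * (sSup ((fun t => ‖g t‖) '' uIcc c d)) * |d - c|)).ultrafilter_le_nhds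
      (l.map fun n => ∫ t in c..d, inner ℝ (v n t) (g t))
      (by
        refine le_principal_iff.2 (mem_map.2 (univ_mem' fun n => ?_))
        simpa using bd n c d)
    exact ⟨L, hL⟩
  choose L hL using ex
  have hadd : ∀ c d, L a d = L a c + L c d := by
    intro c d
    refine tendsto_nhds_unique (hL a d) (((hL a c).add (hL c d)).congr fun n => ?_)
    exact intervalIntegral.integral_add_adjacent_intervals (ii _ (hvm n) (hv n) g hg _ _)
      (ii _ (hvm n) (hv n) g hg _ _)
  -- `D` is the defect between the limit and its expected value; its derivative will vanish
  -- everywhere.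
  set D : ℝ → ℝ := fun x => L a x - ∫ t in a..x, inner ℝ (w t) (g t) with hD
  have hDdiff : ∀ c d, D d - D c = L c d - ∫ t in c..d, inner ℝ (w t) (g t) := by
    intro c d
    have := intervalIntegral.integral_add_adjacent_intervals (ii _ hwm hw g hg a c)
      (ii _ hwm hw g hg c d)
    simp only [hD, hadd c d, ← this]
    ring
  -- Freezing `g` at `c` reduces the main term to a primitive, which converges by `h`. The remainder
  -- costs `C * η * |d - c|` twice: once in the limit and once for `w`.
  have key : ∀ c d η, (∀ t ∈ uIoc c d, ‖g t - g c‖ ≤ η) → |D d - D c| ≤ 2 * C * η * |d - c| := by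
    intro c d η hη
    have hconst : ∀ x : ℝ → H, Measurable x → (∀ᵐ t, ‖x t‖ ≤ C) →
        ∫ t in c..d, inner ℝ (x t) (g t) =
          (∫ t in c..d, inner ℝ (x t) (g t - g c)) + inner ℝ (∫ t in c..d, x t) (g c) := by
      intro x hx hxC
      have h1 : inner ℝ (∫ t in c..d, x t) (g c) = ∫ t in c..d, inner ℝ (x t) (g c) := by
        have := (innerSL ℝ (g c)).intervalIntegral_comp_comm
          (intervalIntegrable_of_ae_norm_le hx hxC c d)
        simp only [innerSL_apply_apply] at this
        rw [real_inner_comm, ← this]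
        simp only [real_inner_comm]
      rw [h1, ← intervalIntegral.integral_add (ii x hx hxC (fun t => g t - g c) (hg.sub continuous_const) c d)
        (ii x hx hxC (fun _ => g c) continuous_const c d)]
      simp only [← inner_add_right, sub_add_cancel]
    have hlim : Tendsto (fun n => ∫ t in c..d, inner ℝ (v n t) (g t - g c)) l
        (𝓝 (L c d - inner ℝ (∫ t in c..d, w t) (g c))) := by
      refine ((hL c d).sub ((h c d).inner tendsto_const_nhds)).congr fun n => ?_
      rw [hconst _ (hvm n) (hv n)]
      ring
    have h1 : |L c d - inner ℝ (∫ t in c..d, w t) (g c)| ≤ C * η * |d - c| :=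
      le_of_tendsto hlim.abs (Eventually.of_forall fun n => abs_intervalIntegral_inner_le (hv n) hη)
    have h2 : |∫ t in c..d, inner ℝ (w t) (g t - g c)| ≤ C * η * |d - c| :=
      abs_intervalIntegral_inner_le hw hη
    rw [hDdiff, hconst w hwm hw]
    calc _ = |(L c d - inner ℝ (∫ t in c..d, w t) (g c)) -
          ∫ t in c..d, inner ℝ (w t) (g t - g c)| := by congr 1; ring
      _ ≤ _ := (abs_sub _ _).trans (by linarith)
  have hderiv : ∀ c, HasDerivAt D 0 c := by
    intro c
    rw [hasDerivAt_iff_isLittleO, Asymptotics.isLittleO_iff]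
    intro η hη
    obtain ⟨δ, hδ, hball⟩ := Metric.continuousAt_iff.1 hg.continuousAt (η / (2 * C + 1))
      (by positivity)
    filter_upwards [Metric.ball_mem_nhds c hδ] with d hd
    have := key c d (η / (2 * C + 1)) fun t ht => by
      have : dist t c < δ := by
        rw [Metric.mem_ball, Real.dist_eq] at hd
        rw [Real.dist_eq]
        refine lt_of_le_of_lt (abs_sub_left_of_mem_uIcc (uIoc_subset_uIcc ht)) hd
      rw [← dist_eq_norm]
      exact (hball this).le
    simp only [smul_zero, sub_zero, Real.norm_eq_abs]
    refine this.trans (mul_le_mul_of_nonneg_right ?_ (abs_nonneg _))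
    rw [← mul_div_assoc, div_le_iff₀ (by positivity)]
    nlinarith
  have hDab : D b = D a := is_const_of_deriv_eq_zero (fun c => (hderiv c).differentiableAt)
    (fun c => (hderiv c).deriv) b a
  have hLaa : L a a = 0 := by linarith [hadd a a]
  have : L a b = ∫ t in a..b, inner ℝ (w t) (g t) := by
    simp only [hD, hLaa, intervalIntegral.integral_same] at hDab
    linarith
  exact this ▸ hL a b

/-- A bounded family whose primitives converge pointwise converges weakly against integrable
functions. -/
theorem tendsto_integral_inner (l : Ultrafilter α) {v : α → ℝ → H}
    {w : ℝ → H} {C : ℝ} (hvm : ∀ n, Measurable (v n)) (hwm : Measurable w)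
    (hv : ∀ n, ∀ᵐ t, ‖v n t‖ ≤ C) (hw : ∀ᵐ t, ‖w t‖ ≤ C)
    (h : ∀ a b, Tendsto (fun n => ∫ t in a..b, v n t) l (𝓝 (∫ t in a..b, w t)))
    {g : ℝ → H} (hg : Integrable g) :
    Tendsto (fun n => ∫ t, inner ℝ (v n t) (g t)) l (𝓝 (∫ t, inner ℝ (w t) (g t))) := by
  have hC0 : 0 ≤ C := by
    obtain ⟨t, ht⟩ := hw.exists
    exact (norm_nonneg _).trans ht
  rw [Metric.tendsto_nhds]
  intro η hη
  obtain ⟨k, hkc, hk, hkcont, hkint⟩ :=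
    hg.exists_hasCompactSupport_integral_sub_le (ε := η / (3 * (C + 1))) (by positivity)
  have hR : ∃ R, ∀ t, k t ≠ 0 → t ∈ Ioc (-R) R := by
    obtain ⟨R, hR⟩ := hkc.isCompact.isBounded.subset_closedBall (0 : ℝ)
    refine ⟨R + 1, fun t ht => ?_⟩
    have := hR (subset_tsupport _ ht)
    rw [Metric.mem_closedBall, Real.dist_eq, sub_zero, abs_le] at this
    constructor <;> linarith
  obtain ⟨R, hR⟩ := hR
  have hsupp : ∀ x : ℝ → H, ∫ t in (-R)..R, inner ℝ (x t) (k t) = ∫ t, inner ℝ (x t) (k t) :=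
    fun x => intervalIntegral.integral_eq_integral_of_support_subset fun t ht =>
      hR t fun h0 => ht (by simp [h0])
  have hlim := tendsto_intervalIntegral_inner_of_continuous l hvm hwm hv hw h hkcont (-R) R
  simp only [hsupp] at hlim
  have happrox : ∀ x : ℝ → H, Measurable x → (∀ᵐ t, ‖x t‖ ≤ C) →
      |(∫ t, inner ℝ (x t) (g t)) - ∫ t, inner ℝ (x t) (k t)| ≤ η / 3 := by
    intro x hx hxC
    rw [← integral_sub (integrable_inner_of_ae_norm_le hx hxC hg)
      (integrable_inner_of_ae_norm_le hx hxC hkint)]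
    simp only [← inner_sub_right]
    calc |∫ t, inner ℝ (x t) (g t - k t)| ≤ ∫ t, C * ‖g t - k t‖ := by
          refine norm_integral_le_of_norm_le (f := fun t => inner ℝ (x t) (g t - k t))
            ((hg.sub hkint).norm.const_mul C) ?_
          filter_upwards [hxC] with t ht
          exact (norm_inner_le_norm _ _).trans (mul_le_mul_of_nonneg_right ht (norm_nonneg _))
      _ = C * ∫ t, ‖g t - k t‖ := integral_const_mul _ _
      _ ≤ (C + 1) * (η / (3 * (C + 1))) := by
          refine mul_le_mul (by linarith) hk (integral_nonneg fun _ => norm_nonneg _) (by positivity)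
      _ = η / 3 := by field_simp
  filter_upwards [Metric.tendsto_nhds.1 hlim (η / 3) (by positivity)] with n hn
  rw [Real.dist_eq] at hn ⊢
  have h1 := happrox _ (hvm n) (hv n)
  have h2 := happrox _ hwm hw
  rw [abs_le] at h1 h2
  rw [abs_lt] at hn ⊢
  constructor <;> linarith [h1.1, h1.2, h2.1, h2.2, hn.1, hn.2]

end WeakConvergence

/-! ### Weak* compactness of the space of controls -/

section Compactness

variable {m : ℕ} {U : Set (EuclideanSpace ℝ (Fin m))}

theorem Control.tendsto_nhds_iff {α : Type*} {l : Filter α} {v : α → Control U} {u : Control U} :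
    Tendsto v l (𝓝 u) ↔ ∀ g : ℝ → EuclideanSpace ℝ (Fin m), Integrable g →
      Tendsto (fun n => ∫ t, inner ℝ ((v n).toFun t) (g t)) l
        (𝓝 (∫ t, inner ℝ (u.toFun t) (g t))) := by
  rw [nhds_iInf]
  simp only [tendsto_iInf, nhds_induced, tendsto_comap_iff, Subtype.forall]
  rfl

theorem Control.exists_ae_norm_le (hU : IsCompact U) :
    ∃ C : ℝ, 0 ≤ C ∧ ∀ u : Control U, ∀ᵐ t, ‖u.toFun t‖ ≤ C := by
  obtain ⟨C, hC⟩ := hU.isBounded.exists_norm_le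
  refine ⟨max C 0, le_max_right _ _, fun u => ?_⟩
  filter_upwards [u.ae_mem] with t ht using (hC _ ht).trans (le_max_left _ _)

/-- A closed convex set contains the averages of functions with values in it. Both orders of `a` and
`b` are needed for two-sided difference quotients. -/
theorem Control.average_mem (hU : IsCompact U) (hconv : Convex ℝ U) (u : Control U) {a b : ℝ}
    (hab : a ≠ b) : (b - a)⁻¹ • ∫ t in a..b, u.toFun t ∈ U := by
  obtain ⟨C, -, hC⟩ := Control.exists_ae_norm_le hU
  wlog hlt : a < b generalizing a b
  · have := this hab.symm (lt_of_le_of_ne (not_lt.1 hlt) hab.symm)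
    rw [intervalIntegral.integral_symm, smul_neg, ← neg_smul, ← inv_neg, neg_sub]
    exact this
  rw [intervalIntegral.integral_of_le hlt.le]
  have hvol : volume (Ioc a b) = ENNReal.ofReal (b - a) := Real.volume_Ioc
  have := hconv.set_average_mem hU.isClosed (μ := volume) (t := Ioc a b) (f := u.toFun)
    (by rw [hvol]; simpa using hlt) (by rw [hvol]; exact ENNReal.ofReal_ne_top)
    (ae_restrict_of_ae u.ae_mem)
    ((intervalIntegrable_iff_integrableOn_Ioc_of_le hlt.le).1
      (intervalIntegrable_of_ae_norm_le u.measurable_toFun (hC u) a b))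
  rwa [setAverage_eq, measureReal_def, hvol, ENNReal.toReal_ofReal (by linarith)] at this

/-- The controls with values in a compact convex set form a weak* compact space. -/
theorem Control.compactSpace (hU : IsCompact U) (hconv : Convex ℝ U) :
    CompactSpace (Control U) := by
  obtain ⟨C, hC0, hC⟩ := Control.exists_ae_norm_le hU
  refine ⟨isCompact_iff_ultrafilter_le_nhds.2 fun l _ => ?_⟩
  have hint : ∀ (u : Control U) a b, IntervalIntegrable u.toFun volume a b := fun u a b =>
    intervalIntegrable_of_ae_norm_le u.measurable_toFun (hC u) a b
  have hbd : ∀ (u : Control U) a b, ‖∫ t in a..b, u.toFun t‖ ≤ C * |b - a| := by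
    intro u a b
    refine intervalIntegral.norm_integral_le_of_norm_le_const_ae ?_
    filter_upwards [hC u] with t ht _ using ht
  have ex : ∀ a, ∃ V, Tendsto (fun u : Control U => ∫ t in 0..a, u.toFun t) l (𝓝 V) := by
    intro a
    obtain ⟨V, -, hV⟩ := (isCompact_closedBall (0 : EuclideanSpace ℝ (Fin m))
      (C * |a - 0|)).ultrafilter_le_nhds (l.map fun u : Control U => ∫ t in 0..a, u.toFun t)
      (le_principal_iff.2 (mem_map.2 (univ_mem' fun u => by simpa using hbd u 0 a)))
    exact ⟨V, hV⟩
  choose V hV using ex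
  have hVd : ∀ a b, Tendsto (fun u : Control U => ∫ t in a..b, u.toFun t) l (𝓝 (V b - V a)) := by
    intro a b
    refine ((hV b).sub (hV a)).congr fun u => ?_
    exact intervalIntegral.integral_interval_sub_left (hint u _ _) (hint u _ _)
  -- The limit `V` of the primitives inherits their Lipschitz bound, hence is differentiable almost
  -- everywhere; its derivative will be the limit control.
  have hVlip : LipschitzWith C.toNNReal V := by
    refine LipschitzWith.of_dist_le_mul fun b a => ?_
    rw [Real.coe_toNNReal C hC0, dist_eq_norm, Real.dist_eq]
    exact le_of_tendsto (hVd a b).norm (Eventually.of_forall fun u => hbd u a b)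
  have hVdiff : ∀ᵐ t, DifferentiableAt ℝ V t := hVlip.ae_differentiableAt
  -- Difference quotients of `V` are limits of averages of controls, so they stay in the closed set
  -- `U`.
  have hmem : ∀ t, DifferentiableAt ℝ V t → deriv V t ∈ U := by
    intro t ht
    refine hU.isClosed.mem_of_tendsto ht.hasDerivAt.tendsto_slope ?_
    filter_upwards [self_mem_nhdsWithin] with s hs
    rw [slope_def_module]
    exact hU.isClosed.mem_of_tendsto ((hVd t s).const_smul (s - t)⁻¹)
      (Eventually.of_forall fun u => u.average_mem hU hconv (Ne.symm hs))
  let u : Control U := ⟨deriv V, measurable_deriv V, hVdiff.mono hmem⟩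
  have hu : ∀ a b, ∫ t in a..b, u.toFun t = V b - V a := by
    intro a b
    have hac : AbsolutelyContinuousOnInterval (fun x => V x - ∫ t in a..x, u.toFun t) a b := by
      refine (hVlip.lipschitzOnWith.absolutelyContinuousOnInterval).sub
        (LipschitzWith.lipschitzOnWith (K := C.toNNReal)
          (LipschitzWith.of_dist_le_mul fun y x => ?_)).absolutelyContinuousOnInterval
      rw [Real.coe_toNNReal C hC0, dist_eq_norm, Real.dist_eq,
        intervalIntegral.integral_interval_sub_left (hint u _ _) (hint u _ _)]
      exact hbd u x y
    obtain ⟨c, hc⟩ := hac.const_of_ae_hasDerivAt_zero (by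
      filter_upwards [hVdiff,
        LocallyIntegrable.ae_hasDerivAt_integral
          (locallyIntegrable_of_ae_norm_le u.measurable_toFun (hC u))]
        with t ht1 ht2 _
      have := ht1.hasDerivAt.sub (ht2 a)
      rw [show u.toFun t = deriv V t from rfl, sub_self] at this
      exact this)
    have h1 := hc a left_mem_uIcc
    have h2 := hc b right_mem_uIcc
    simp only [intervalIntegral.integral_same, sub_zero] at h1 h2
    rw [h1, ← h2]
    abel
  refine ⟨u, mem_univ _, ?_⟩
  have : Tendsto id (l : Filter (Control U)) (𝓝 u) := by
    rw [Control.tendsto_nhds_iff]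
    intro g hg
    exact tendsto_integral_inner l (fun n => n.measurable_toFun) u.measurable_toFun hC (hC u)
      (fun a b => by rw [hu]; exact hVd a b) hg
  exact this

end Compactness

/-! ### Embeddings near a compact set, and Lipschitz bounds for the Riemannian distance -/

section Embedding

open scoped NNReal

variable {d : ℕ} {M : Type*} [MetricSpace M] [ChartedSpace (EuclideanSpace ℝ (Fin d)) M]
  {E : Type*} [NormedAddCommGroup E] [NormedSpace ℝ E]

/-- A smooth Lipschitz map `F : M → E` that restricts to an injective map on `Q` and has a local
`C¹` left inverse near every point of `Q`. -/
structure IsEmbeddingNear (d : ℕ) {M : Type*} [MetricSpace M]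
    [ChartedSpace (EuclideanSpace ℝ (Fin d)) M] {E : Type*} [NormedAddCommGroup E]
    [NormedSpace ℝ E] (Q : Set M) (F : M → E) : Prop where
  contMDiff : ContMDiff (𝓡 d) 𝓘(ℝ, E) ∞ F
  injOn : InjOn F Q
  exists_lipschitzWith : ∃ C : ℝ≥0, LipschitzWith C F
  exists_leftInverse : ∀ q ∈ Q, ∃ G : E → M, ContMDiffAt 𝓘(ℝ, E) (𝓡 d) 1 G (F q) ∧
    ∀ᶠ x in 𝓝 q, G (F x) = x

/-- Compactness of `Q ×ˢ Q` globalizes the estimate: near the diagonal it is assumed, and near other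
pairs `D` is bounded while injectivity keeps `‖F x - F y‖` away from zero. -/
theorem IsEmbeddingNear.exists_le_mul_norm_sub {Q : Set M} (hQ : IsCompact Q) {F : M → E}
    (hF : IsEmbeddingNear d Q F) {D : M × M → ℝ} (hD : Continuous D)
    (hloc : ∀ q ∈ Q, ∃ L : ℝ, ∀ᶠ z in 𝓝 (q, q), D z ≤ L * ‖F z.1 - F z.2‖) :
    ∃ L : ℝ, 0 ≤ L ∧ ∀ x ∈ Q, ∀ y ∈ Q, D (x, y) ≤ L * ‖F x - F y‖ := by
  have key : ∃ L : ℝ, 0 ≤ L ∧ ∀ z ∈ Q ×ˢ Q, D z ≤ L * ‖F z.1 - F z.2‖ := by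
    refine (hQ.prod hQ).induction_on (p := fun s => ∃ L : ℝ, 0 ≤ L ∧ ∀ z ∈ s, D z ≤
      L * ‖F z.1 - F z.2‖) ⟨0, le_rfl, by simp⟩ ?_ ?_ ?_
    · rintro s t hst ⟨L, hL, h⟩
      exact ⟨L, hL, fun z hz => h z (hst hz)⟩
    · rintro s t ⟨L, hL, h⟩ ⟨L', hL', h'⟩
      refine ⟨max L L', hL.trans (le_max_left _ _), ?_⟩
      rintro z (hz | hz)
      · exact (h z hz).trans (mul_le_mul_of_nonneg_right (le_max_left _ _) (norm_nonneg _))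
      · exact (h' z hz).trans (mul_le_mul_of_nonneg_right (le_max_right _ _) (norm_nonneg _))
    · rintro ⟨x, y⟩ ⟨hx, hy⟩
      obtain rfl | hxy := eq_or_ne x y
      · obtain ⟨L, hL⟩ := hloc x hx
        refine ⟨_, nhdsWithin_le_nhds hL, max L 0, le_max_right _ _, fun z hz => ?_⟩
        exact le_trans hz (mul_le_mul_of_nonneg_right (le_max_left _ _) (norm_nonneg _))
      · have hpos : 0 < ‖F x - F y‖ :=
          norm_pos_iff.2 (sub_ne_zero.2 fun h => hxy (hF.injOn hx hy h))
        have hFc : Continuous fun z : M × M => ‖F z.1 - F z.2‖ :=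
          ((hF.contMDiff.continuous.comp continuous_fst).sub
            (hF.contMDiff.continuous.comp continuous_snd)).norm
        have h1 : ∀ᶠ z in 𝓝 (x, y), ‖F x - F y‖ / 2 < ‖F z.1 - F z.2‖ :=
          hFc.continuousAt.eventually_const_lt (by simpa using hpos)
        have h2 : ∀ᶠ z in 𝓝 (x, y), D z < |D (x, y)| + 1 :=
          hD.continuousAt.eventually_lt_const (by linarith [le_abs_self (D (x, y))])
        refine ⟨_, nhdsWithin_le_nhds (h1.and h2), (|D (x, y)| + 1) / (‖F x - F y‖ / 2),
          by positivity, fun z hz => ?_⟩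
        rw [div_mul_eq_mul_div, le_div_iff₀ (by positivity)]
        exact mul_le_mul hz.2.le hz.1.le (by positivity) (by positivity)
  obtain ⟨L, hL, h⟩ := key
  exact ⟨L, hL, fun x hx y hy => h (x, y) ⟨hx, hy⟩⟩

/-- Near a point of `Q`, `h` factors as `(h ∘ G) ∘ F` with `h ∘ G` of class `C¹`, hence locally
Lipschitz. -/
theorem IsEmbeddingNear.exists_norm_sub_le [IsManifold (𝓡 d) ∞ M] {Q : Set M} (hQ : IsCompact Q)
    {F : M → E} (hF : IsEmbeddingNear d Q F) {E' : Type*} [NormedAddCommGroup E'] [NormedSpace ℝ E']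
    {h : M → E'} (hh : ContMDiff (𝓡 d) 𝓘(ℝ, E') 1 h) :
    ∃ L : ℝ, 0 ≤ L ∧ ∀ x ∈ Q, ∀ y ∈ Q, ‖h x - h y‖ ≤ L * ‖F x - F y‖ := by
  refine hF.exists_le_mul_norm_sub hQ (D := fun z => ‖h z.1 - h z.2‖)
    ((hh.continuous.comp continuous_fst).sub (hh.continuous.comp continuous_snd)).norm
    fun q hq => ?_
  obtain ⟨G, hG, hGF⟩ := hF.exists_leftInverse q hq
  have hc : ContDiffAt ℝ 1 (h ∘ G) (F q) := by
    rw [← contMDiffAt_iff_contDiffAt]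
    exact hh.contMDiffAt.comp _ hG
  obtain ⟨K, s, hs, hK⟩ := hc.exists_lipschitzOnWith
  refine ⟨K, ?_⟩
  have hs' : ∀ᶠ x in 𝓝 q, F x ∈ s := hF.contMDiff.continuous.continuousAt hs
  rw [nhds_prod_eq]
  filter_upwards [(hGF.and hs').prod_mk (hGF.and hs')] with z hz
  have := hK.dist_le_mul _ hz.1.2 _ hz.2.2
  simpa [Function.comp, hz.1.1, hz.2.1, dist_eq_norm] using this

variable [Bundle.RiemannianBundle (fun x : M => TangentSpace (𝓡 d) x)]

theorem isContinuousRiemannianBundle (d : ℕ) (M : Type*) [MetricSpace M]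
    [ChartedSpace (EuclideanSpace ℝ (Fin d)) M] [IsManifold (𝓡 d) ∞ M]
    [Bundle.RiemannianBundle (fun x : M => TangentSpace (𝓡 d) x)]
    [IsContMDiffRiemannianBundle (𝓡 d) ∞ (EuclideanSpace ℝ (Fin d))
      (fun x : M => TangentSpace (𝓡 d) x)] :
    IsContinuousRiemannianBundle (EuclideanSpace ℝ (Fin d))
      (fun x : M => TangentSpace (𝓡 d) x) := by
  obtain ⟨g, hg, h⟩ := IsContMDiffRiemannianBundle.exists_contMDiff (IB := 𝓡 d) (n := ∞)
    (F := EuclideanSpace ℝ (Fin d)) (E := fun x : M => TangentSpace (𝓡 d) x)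
  exact ⟨g, hg.continuous, h⟩

section

open Manifold Metric

attribute [local instance] normedAddCommGroupTangentSpaceVectorSpace
attribute [local instance] normedSpaceTangentSpaceVectorSpace

/-- The inverse chart has bounded differential near `p`, so the curve that is a straight segment in
the chart has length at most `C` times the distance of its endpoints there. -/
theorem eventually_edist_le_mul_edist_extChartAt [IsManifold (𝓡 d) ∞ M]
    [IsContMDiffRiemannianBundle (𝓡 d) ∞ (EuclideanSpace ℝ (Fin d))
      (fun x : M => TangentSpace (𝓡 d) x)]
    [IsRiemannianManifold (𝓡 d) M] (p : M) :
    ∃ C : ℝ≥0, ∀ᶠ z in 𝓝 (p, p), edist (z : M × M).1 z.2 ≤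
      C * edist (extChartAt (𝓡 d) p z.1) (extChartAt (𝓡 d) p z.2) := by
  have : IsContinuousRiemannianBundle (EuclideanSpace ℝ (Fin d))
    (fun x : M => TangentSpace (𝓡 d) x) := isContinuousRiemannianBundle d M
  rcases eventually_enorm_mfderivWithin_symm_extChartAt_lt (𝓡 d) p with ⟨C, C_pos, hC'⟩
  set S : Set (EuclideanSpace ℝ (Fin d)) := {y | ∀ v : EuclideanSpace ℝ (Fin d),
    ‖mfderivWithin 𝓘(ℝ, EuclideanSpace ℝ (Fin d)) (𝓡 d) (extChartAt (𝓡 d) p).symm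
      (range (𝓡 d)) y v‖ₑ ≤ C * ‖v‖ₑ}
  have hC : S ∈ 𝓝[range (𝓡 d)] (extChartAt (𝓡 d) p p) := by
    filter_upwards [hC'] with y hy v
    exact (ContinuousLinearMap.le_opENorm _ _).trans (mul_le_mul' hy.le (le_of_eq rfl))
  refine ⟨C, ?_⟩
  obtain ⟨r, r_pos, hr⟩ : ∃ r > 0,
      ball (extChartAt (𝓡 d) p p) r ∩ range (𝓡 d) ⊆ (extChartAt (𝓡 d) p).target ∩
        S :=
    mem_nhdsWithin_iff.1 (inter_mem (extChartAt_target_mem_nhdsWithin p) hC)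
  have A : (extChartAt (𝓡 d) p) ⁻¹' (ball (extChartAt (𝓡 d) p p) r ∩ range (𝓡 d)) ∈ 𝓝 p := by
    apply extChartAt_preimage_mem_nhds_of_mem_nhdsWithin (by simp)
    rw [inter_comm]
    exact inter_mem_nhdsWithin _ (ball_mem_nhds _ r_pos)
  have B := inter_mem A (chart_source_mem_nhds (EuclideanSpace ℝ (Fin d)) p)
  rw [nhds_prod_eq]
  filter_upwards [prod_mem_prod B B] with z hz
  obtain ⟨x, y⟩ := z
  obtain ⟨⟨hx, h'x⟩, ⟨hy, h'y⟩⟩ := hz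
  let η := ContinuousAffineMap.lineMap (R := ℝ) (extChartAt (𝓡 d) p x) (extChartAt (𝓡 d) p y)
  set γ := (extChartAt (𝓡 d) p).symm ∘ η
  have hη : Icc 0 1 ⊆ ⇑η ⁻¹' ((extChartAt (𝓡 d) p).target ∩
        S) := by
    simp only [← image_subset_iff, ContinuousAffineMap.coe_lineMap_eq,
     ← segment_eq_image_lineMap, η]
    apply Subset.trans _ hr
    exact ((convex_ball _ _).inter (𝓡 d).convex_range).segment_subset hx hy
  simp only [preimage_inter, subset_inter_iff] at hη
  have η_smooth : CMDiff[Icc 0 1] 1 η := by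
    apply ContMDiff.contMDiffOn
    rw [contMDiff_iff_contDiff]
    exact ContinuousAffineMap.contDiff _
  have : riemannianEDist (𝓡 d) x y ≤ pathELength (𝓡 d) γ 0 1 := by
    apply riemannianEDist_le_pathELength _ _ _ zero_le_one
    · exact (contMDiffOn_extChartAt_symm p).comp η_smooth hη.1
    · simp [γ, η, ContinuousAffineMap.coe_lineMap_eq, h'x]
    · simp [γ, η, ContinuousAffineMap.coe_lineMap_eq, h'y]
  rw [IsRiemannianManifold.out (I := 𝓡 d) x y]
  apply this.trans
  rw [← lintegral_fderiv_lineMap_eq_edist, pathELength_eq_lintegral_mfderivWithin_Icc,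
    ← lintegral_const_mul' _ _ ENNReal.coe_ne_top]
  apply setLIntegral_mono' measurableSet_Icc (fun t ht ↦ ?_)
  have : mfderivWithin 𝓘(ℝ, ℝ) (𝓡 d) γ (Icc 0 1) t =
      (mfderivWithin 𝓘(ℝ, EuclideanSpace ℝ (Fin d)) (𝓡 d) (extChartAt (𝓡 d) p).symm (range (𝓡 d)) (η t)) ∘L (mfderiv[Icc 0 1] η t) := by
    apply mfderivWithin_comp
    · exact mdifferentiableWithinAt_extChartAt_symm (hη.1 ht)
    · exact η_smooth.mdifferentiableOn one_ne_zero t ht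
    · exact hη.1.trans (preimage_mono (extChartAt_target_subset_range p))
    · rw [uniqueMDiffWithinAt_iff_uniqueDiffWithinAt]
      exact uniqueDiffOn_Icc zero_lt_one t ht
  have : mfderivWithin 𝓘(ℝ, ℝ) (𝓡 d) γ (Icc 0 1) t 1 =
      (mfderivWithin 𝓘(ℝ, EuclideanSpace ℝ (Fin d)) (𝓡 d) (extChartAt (𝓡 d) p).symm (range (𝓡 d)) (η t)) (mfderiv[Icc 0 1] η t 1) :=
    congr($this 1)
  rw [this]
  refine (hη.2 ht _).trans ?_
  simp only [mfderivWithin_eq_fderivWithin]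
  exact le_of_eq rfl

/-- A `C¹` map whose differential is bounded by `C` is `C`-Lipschitz for the Riemannian
distance. -/
theorem lipschitzWith_of_enorm_mfderiv_le [IsManifold (𝓡 d) ∞ M] [IsRiemannianManifold (𝓡 d) M]
    {F : M → E} (hF : ContMDiff (𝓡 d) 𝓘(ℝ, E) 1 F) {C : ℝ≥0}
    (hC : ∀ x (v : TangentSpace (𝓡 d) x),
      ‖(show E from mfderiv (𝓡 d) 𝓘(ℝ, E) F x v)‖ₑ ≤ C * ‖v‖ₑ) :
    LipschitzWith C F := by
  intro x y
  rw [edist_comm x, edist_comm (F x), IsRiemannianManifold.out (I := 𝓡 d) y x]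
  refine le_of_forall_gt_imp_ge_of_dense fun r hr => ?_
  have hr' : ∃ r', riemannianEDist (𝓡 d) y x < r' ∧ C * r' ≤ r := by
    by_contra! hcon
    -- For `C = 0` division fails, but the distance is finite and `0 * ⊤ = 0`, so `r' = ⊤` serves.
    obtain rfl | hC0 := eq_or_ne C 0
    · obtain h := hcon ⊤ (by
        refine lt_top_iff_ne_top.2 ?_
        rw [← IsRiemannianManifold.out (I := 𝓡 d) y x]
        exact edist_ne_top _ _)
      simp at h
    · refine absurd (hcon (r / C) ?_) ?_
      · rw [ENNReal.lt_div_iff_mul_lt (by simp [hC0]) (by simp)]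
        rwa [mul_comm]
      · rw [not_lt]
        exact ENNReal.mul_div_le
  obtain ⟨r', hr', hrr⟩ := hr'
  obtain ⟨γ, γ0, γ1, hγ, hlen⟩ := exists_lt_of_riemannianEDist_lt hr'
  have hcomp : ContDiffOn ℝ 1 (F ∘ γ) (Icc 0 1) := by
    rw [← contMDiffOn_iff_contDiffOn]
    exact hF.comp_contMDiffOn hγ
  calc edist (F y) (F x) = ‖(F ∘ γ) 1 - (F ∘ γ) 0‖ₑ := by
        rw [Function.comp, Function.comp, γ0, γ1, edist_comm, edist_eq_enorm_sub]
    _ ≤ ∫⁻ t in Icc 0 1, ‖derivWithin (F ∘ γ) (Icc 0 1) t‖ₑ :=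
        enorm_sub_le_lintegral_derivWithin_Icc_of_contDiffOn_Icc hcomp zero_le_one
    _ ≤ ∫⁻ t in Icc (0 : ℝ) 1, C * ‖mfderivWithin 𝓘(ℝ, ℝ) (𝓡 d) γ (Icc 0 1) t 1‖ₑ := by
        refine setLIntegral_mono' measurableSet_Icc fun t ht => ?_
        have h1 : mfderivWithin 𝓘(ℝ, ℝ) 𝓘(ℝ, E) (F ∘ γ) (Icc 0 1) t =
            (mfderiv (𝓡 d) 𝓘(ℝ, E) F (γ t)) ∘L
              (mfderivWithin 𝓘(ℝ, ℝ) (𝓡 d) γ (Icc 0 1) t) := by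
          apply mfderiv_comp_mfderivWithin
          · exact hF.mdifferentiable one_ne_zero _
          · exact hγ.mdifferentiableOn one_ne_zero t ht
          · rw [uniqueMDiffWithinAt_iff_uniqueDiffWithinAt]
            exact uniqueDiffOn_Icc zero_lt_one t ht
        have h2 : derivWithin (F ∘ γ) (Icc 0 1) t =
            mfderiv (𝓡 d) 𝓘(ℝ, E) F (γ t) (mfderivWithin 𝓘(ℝ, ℝ) (𝓡 d) γ (Icc 0 1) t 1) := by
          rw [← fderivWithin_derivWithin, ← mfderivWithin_eq_fderivWithin]
          exact congr($h1 1)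
        rw [h2]
        exact hC _ _
    _ = C * pathELength (𝓡 d) γ 0 1 := by
        rw [lintegral_const_mul' _ _ ENNReal.coe_ne_top,
          pathELength_eq_lintegral_mfderivWithin_Icc]
    _ ≤ r := le_trans (mul_le_mul_right hlen.le _) hrr

end

end Embedding

/-! ### Construction of the embedding -/

section Existence

open scoped NNReal

variable {d : ℕ} {M : Type*} [MetricSpace M] [ChartedSpace (EuclideanSpace ℝ (Fin d)) M]
  [IsManifold (𝓡 d) ∞ M]
  [Bundle.RiemannianBundle (fun x : M => TangentSpace (𝓡 d) x)]
  [IsContMDiffRiemannianBundle (𝓡 d) ∞ (EuclideanSpace ℝ (Fin d))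
      (fun x : M => TangentSpace (𝓡 d) x)]
  {E : Type*} [NormedAddCommGroup E] [NormedSpace ℝ E]

/-- Locally the Riemannian distance is bounded by the chart distance, and the chart read through the
left inverse `G` is a Lipschitz function of `F`. -/
theorem IsEmbeddingNear.exists_dist_le [IsRiemannianManifold (𝓡 d) M] {Q : Set M}
    (hQ : IsCompact Q) {F : M → E} (hF : IsEmbeddingNear d Q F) :
    ∃ L : ℝ, 0 ≤ L ∧ ∀ x ∈ Q, ∀ y ∈ Q, dist x y ≤ L * ‖F x - F y‖ := by
  refine hF.exists_le_mul_norm_sub hQ (D := fun z => dist z.1 z.2) continuous_dist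
    fun q hq => ?_
  obtain ⟨C, hC⟩ := eventually_edist_le_mul_edist_extChartAt (d := d) q
  obtain ⟨G, hG, hGF⟩ := hF.exists_leftInverse q hq
  have hc : ContDiffAt ℝ 1 (extChartAt (𝓡 d) q ∘ G) (F q) := by
    rw [← contMDiffAt_iff_contDiffAt]
    have h1 : ContMDiffAt (𝓡 d) 𝓘(ℝ, EuclideanSpace ℝ (Fin d)) 1 (extChartAt (𝓡 d) q)
        (G (F q)) := by
      rw [hGF.self_of_nhds]
      exact contMDiffAt_extChartAt
    exact h1.comp _ hG
  obtain ⟨K, s, hs, hK⟩ := hc.exists_lipschitzOnWith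
  refine ⟨C * K, ?_⟩
  have hs' : ∀ᶠ x in 𝓝 q, F x ∈ s := hF.contMDiff.continuous.continuousAt hs
  rw [nhds_prod_eq] at hC ⊢
  filter_upwards [(hGF.and hs').prod_mk (hGF.and hs'), hC] with z hz hz'
  have h1 := hK.dist_le_mul _ hz.1.2 _ hz.2.2
  simp only [Function.comp, hz.1.1, hz.2.1] at h1
  have h2 : dist z.1 z.2 ≤ C * dist (extChartAt (𝓡 d) q z.1) (extChartAt (𝓡 d) q z.2) := by
    rw [edist_dist, edist_dist, ← ENNReal.ofReal_coe_nnreal, ← ENNReal.ofReal_mul C.coe_nonneg,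
      ENNReal.ofReal_le_ofReal_iff (by positivity)] at hz'
    exact hz'
  rw [mul_assoc, ← dist_eq_norm]
  exact h2.trans (mul_le_mul_of_nonneg_left h1 C.coe_nonneg)

attribute [local instance] normedAddCommGroupTangentSpaceVectorSpace
attribute [local instance] normedSpaceTangentSpaceVectorSpace

/-- Chain rule through the chart at `p`: the chart has bounded differential in the Riemannian norm,
and `F` read in the chart is `C¹`. -/
theorem eventually_enorm_mfderiv_le {F : M → E} (hF : ContMDiff (𝓡 d) 𝓘(ℝ, E) 1 F) (p : M) :
    ∃ C : ℝ≥0, ∀ᶠ x in 𝓝 p, ∀ v : TangentSpace (𝓡 d) x,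
      ‖(show E from mfderiv (𝓡 d) 𝓘(ℝ, E) F x v)‖ₑ ≤ C * ‖v‖ₑ := by
  have : IsContinuousRiemannianBundle (EuclideanSpace ℝ (Fin d))
    (fun x : M => TangentSpace (𝓡 d) x) := isContinuousRiemannianBundle d M
  obtain ⟨C, -, hC⟩ := eventually_enorm_mfderiv_extChartAt_lt (𝓡 d) p
  set ψ := extChartAt (𝓡 d) p
  have hψ : ContMDiffAt 𝓘(ℝ, EuclideanSpace ℝ (Fin d)) (𝓡 d) 1 ψ.symm (ψ p) := by
    have := contMDiffOn_extChartAt_symm (I := 𝓡 d) (n := 1) p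
    exact this.contMDiffAt (extChartAt_target_mem_nhds p)
  have hc : ContDiffAt ℝ 1 (F ∘ ψ.symm) (ψ p) := by
    rw [← contMDiffAt_iff_contDiffAt]
    exact hF.contMDiffAt.comp _ hψ
  have hev : ∀ᶠ y in 𝓝 (ψ p), DifferentiableAt ℝ (F ∘ ψ.symm) y ∧
      ‖fderiv ℝ (F ∘ ψ.symm) y‖ < ‖fderiv ℝ (F ∘ ψ.symm) (ψ p)‖ + 1 := by
    refine ((hc.eventually (by simp)).mono fun y hy => hy.differentiableAt one_ne_zero).and ?_
    exact ((hc.fderiv_right (m := 0) (by simp)).continuousAt.norm).eventually_lt_const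
      (by linarith)
  refine ⟨(‖fderiv ℝ (F ∘ ψ.symm) (ψ p)‖₊ + 1) * C, ?_⟩
  filter_upwards [hC, (continuousAt_extChartAt p).eventually hev,
    eventually_eventually_nhds.2 (extChartAt_source_mem_nhds (I := 𝓡 d) p)] with x hx hx' hsrc v
  have heq : F =ᶠ[𝓝 x] (F ∘ ψ.symm) ∘ ψ := by
    filter_upwards [hsrc] with y hy
    simp [Function.comp, ψ.left_inv hy]
  have hmd : MDifferentiableAt (𝓡 d) 𝓘(ℝ, EuclideanSpace ℝ (Fin d)) ψ x :=
    mdifferentiableAt_extChartAt (by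
      rw [← extChartAt_source (𝓡 d)]
      exact hsrc.self_of_nhds)
  have h1 : mfderiv (𝓡 d) 𝓘(ℝ, E) F x =
      (mfderiv 𝓘(ℝ, EuclideanSpace ℝ (Fin d)) 𝓘(ℝ, E) (F ∘ ψ.symm) (ψ x)) ∘L
        (mfderiv (𝓡 d) 𝓘(ℝ, EuclideanSpace ℝ (Fin d)) ψ x) := by
    rw [heq.mfderiv_eq]
    exact mfderiv_comp x hx'.1.mdifferentiableAt hmd
  have h2 : (show E from mfderiv (𝓡 d) 𝓘(ℝ, E) F x v) =
      fderiv ℝ (F ∘ ψ.symm) (ψ x)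
        (mfderiv (𝓡 d) 𝓘(ℝ, EuclideanSpace ℝ (Fin d)) ψ x v) := by
    rw [h1, mfderiv_eq_fderiv]
    rfl
  rw [h2]
  refine (ContinuousLinearMap.le_opENorm _ _).trans ?_
  rw [ENNReal.coe_mul, mul_assoc]
  gcongr
  · rw [enorm_eq_nnnorm, ENNReal.coe_le_coe, ← NNReal.coe_le_coe]
    exact hx'.2.le
  · exact (ContinuousLinearMap.le_opENorm _ _).trans (by gcongr; exact hx.le)

theorem exists_lipschitzWith_of_hasCompactSupport [IsRiemannianManifold (𝓡 d) M] {F : M → E}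
    (hF : ContMDiff (𝓡 d) 𝓘(ℝ, E) 1 F) (hsupp : HasCompactSupport F) :
    ∃ C : ℝ≥0, LipschitzWith C F := by
  have key : ∃ C : ℝ≥0, ∀ x ∈ tsupport F, ∀ v : TangentSpace (𝓡 d) x,
      ‖(show E from mfderiv (𝓡 d) 𝓘(ℝ, E) F x v)‖ₑ ≤ C * ‖v‖ₑ := by
    refine hsupp.isCompact.induction_on (p := fun s => ∃ C : ℝ≥0, ∀ x ∈ s,
      ∀ v : TangentSpace (𝓡 d) x, ‖(show E from mfderiv (𝓡 d) 𝓘(ℝ, E) F x v)‖ₑ ≤ C * ‖v‖ₑ)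
      ⟨0, by simp⟩ ?_ ?_ ?_
    · rintro s t hst ⟨C, h⟩
      exact ⟨C, fun x hx => h x (hst hx)⟩
    · rintro s t ⟨C, h⟩ ⟨C', h'⟩
      refine ⟨C + C', ?_⟩
      rintro x (hx | hx) v
      · exact (h x hx v).trans (by gcongr; simp)
      · exact (h' x hx v).trans (by gcongr; simp)
    · intro x _
      obtain ⟨C, hC⟩ := eventually_enorm_mfderiv_le hF x
      exact ⟨_, nhdsWithin_le_nhds hC, C, fun y hy => hy⟩
  obtain ⟨C, hC⟩ := key
  refine ⟨C, lipschitzWith_of_enorm_mfderiv_le hF fun x v => ?_⟩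
  by_cases hx : x ∈ tsupport F
  · exact hC x hx v
  · have h0 : F =ᶠ[𝓝 x] fun _ => 0 := by
      rw [notMem_tsupport_iff_eventuallyEq] at hx
      exact hx
    have : (show E from mfderiv (𝓡 d) 𝓘(ℝ, E) F x v) = 0 := by
      rw [h0.mfderiv_eq, mfderiv_const]
      rfl
    rw [this]
    simp

/-- Each component records a bump function and the chart multiplied by it. If `b i x = 1`, equality
of images forces `b i y = 1`, and then the chart separates `x` from `y`. Compact support of the
bumps gives the global Lipschitz bound. -/
theorem exists_isEmbeddingNear [IsRiemannianManifold (𝓡 d) M] {Q : Set M} (hQ : IsCompact Q) :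
    ∃ (s : Finset M) (F : M → (s → EuclideanSpace ℝ (Fin d) × ℝ)), IsEmbeddingNear d Q F := by
  let b : ∀ p : M, SmoothBumpFunction (𝓡 d) p := fun p => Classical.arbitrary _
  -- The bump must equal `1` on a neighborhood of each point, not only at the point, for the inverse
  -- chart to be a left inverse there.
  obtain ⟨s, -, hs⟩ := hQ.elim_nhds_subcover (fun p => {x | b p =ᶠ[𝓝 x] 1})
    fun p _ => eventually_eventually_nhds.2 (b p).eventuallyEq_one
  let F : M → (s → EuclideanSpace ℝ (Fin d) × ℝ) :=
    fun x i => (b i x • extChartAt (𝓡 d) (i : M) x, b i x)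
  have hFs : ContMDiff (𝓡 d) 𝓘(ℝ, s → EuclideanSpace ℝ (Fin d) × ℝ) ∞ F :=
    contMDiff_pi_space.2 fun i =>
      ((b i).contMDiff_smul contMDiffOn_extChartAt).prodMk_space (b i).contMDiff
  have hcov : ∀ q ∈ Q, ∃ i : s, b i =ᶠ[𝓝 q] 1 := by
    intro q hq
    obtain ⟨i, hi, hqi⟩ := mem_iUnion₂.1 (hs hq)
    exact ⟨⟨i, hi⟩, hqi⟩
  have hsrc : ∀ (i : s) x, b i x = 1 → x ∈ (extChartAt (𝓡 d) (i : M)).source := by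
    intro i x hx
    rw [extChartAt_source]
    exact (b i).support_subset_source (by simp [Function.mem_support, hx])
  refine ⟨s, F, hFs, ?_, ?_, ?_⟩
  · intro x hx y _ hxy
    obtain ⟨i, hi⟩ := hcov x hx
    have hix : b i x = 1 := hi.self_of_nhds
    have h := congr_fun hxy i
    simp only [F, Prod.mk.injEq] at h
    have hiy : b i y = 1 := h.2 ▸ hix
    rw [hix, hiy, one_smul, one_smul] at h
    exact (extChartAt (𝓡 d) (i : M)).injOn (hsrc i x hix) (hsrc i y hiy) h.1
  · refine exists_lipschitzWith_of_hasCompactSupport (hFs.of_le (by simp)) ?_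
    refine HasCompactSupport.intro (K := ⋃ i : s, tsupport (b i))
      (isCompact_iUnion fun i => (b i).hasCompactSupport) fun x hx => ?_
    simp only [mem_iUnion, not_exists] at hx
    ext1 i
    have : b i x = 0 := image_eq_zero_of_notMem_tsupport (hx i)
    simp [F, this]
  · intro q hq
    obtain ⟨i, hi⟩ := hcov q hq
    have hiq : b i q = 1 := hi.self_of_nhds
    refine ⟨fun e => (extChartAt (𝓡 d) (i : M)).symm (e i).1, ?_, ?_⟩
    · have h1 : ContMDiffAt 𝓘(ℝ, EuclideanSpace ℝ (Fin d)) (𝓡 d) 1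
          (extChartAt (𝓡 d) (i : M)).symm (F q i).1 := by
        refine (contMDiffOn_extChartAt_symm (I := 𝓡 d) (n := 1) (i : M)).contMDiffAt
          ((isOpen_extChartAt_target (i : M)).mem_nhds ?_)
        simp only [F, hiq, one_smul]
        exact (extChartAt (𝓡 d) (i : M)).map_source (hsrc i q hiq)
      have h2 : ContMDiffAt 𝓘(ℝ, s → EuclideanSpace ℝ (Fin d) × ℝ)
          𝓘(ℝ, EuclideanSpace ℝ (Fin d)) 1
          (fun e : s → EuclideanSpace ℝ (Fin d) × ℝ => (e i).1) (F q) := by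
        rw [contMDiffAt_iff_contDiffAt]
        exact ((contDiff_apply ℝ _ i).fst).contDiffAt
      exact h1.comp (F q) h2
    · filter_upwards [hi] with x hx
      have hix : b i x = 1 := hx
      simp only [F, hix, one_smul]
      exact (extChartAt (𝓡 d) (i : M)).left_inv (hsrc i x hix)

end Existence

/-! ### Grönwall's inequality in integral form -/

section Gronwall

/-- The majorant `w` is differentiable with `w' = L v ≤ L w`, so the differential Grönwall
inequality applies to `w` although `v` is merely continuous. -/
theorem le_mul_exp_of_le_add_integral {v : ℝ → ℝ} (hv : Continuous v) {L : ℝ} (hL : 0 ≤ L)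
    {a b : ℝ} (hab : a ≤ b) (h : ∀ t ∈ Icc a b, v t ≤ v a + L * ∫ r in a..t, v r) :
    v b ≤ v a * Real.exp (L * (b - a)) := by
  set w : ℝ → ℝ := fun t => v a + L * ∫ r in a..t, v r
  have hw : ∀ t, HasDerivAt w (L * v t) t := fun t =>
    ((intervalIntegral.integral_hasDerivAt_right (hv.intervalIntegrable a t)
      (hv.stronglyMeasurableAtFilter _ _) hv.continuousAt).const_mul L).const_add (v a)
  have hwc : ContinuousOn w (Icc a b) := fun t _ => (hw t).continuousAt.continuousWithinAt
  have := le_gronwallBound_of_liminf_deriv_right_le (f := w) (f' := fun t => L * v t)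
    (δ := v a) (K := L) (ε := 0) hwc
    (fun t _ r hr => (hw t).hasDerivWithinAt.liminf_right_slope_le hr)
    (by simp [w]) (fun t ht => by
      rw [add_zero]
      exact mul_le_mul_of_nonneg_left (h t (Ico_subset_Icc_self ht)) hL) b (right_mem_Icc.2 hab)
  rw [gronwallBound_ε0] at this
  exact (h b (right_mem_Icc.2 hab)).trans this

/-- Reflection `t ↦ -t` covers `b < a`. The backward direction is what bounds the loss of volume
under the flow. -/
theorem le_mul_exp_of_le_add_abs_integral {v : ℝ → ℝ} (hv : Continuous v) (hv0 : ∀ t, 0 ≤ v t)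
    {L : ℝ} (hL : 0 ≤ L) {a b : ℝ}
    (h : ∀ t ∈ uIcc a b, v t ≤ v a + L * |∫ r in a..t, v r|) :
    v b ≤ v a * Real.exp (L * |b - a|) := by
  rcases le_total a b with hab | hab
  · rw [uIcc_of_le hab] at h
    rw [abs_of_nonneg (by linarith)]
    refine le_mul_exp_of_le_add_integral hv hL hab fun t ht => ?_
    have := h t ht
    rwa [abs_of_nonneg (intervalIntegral.integral_nonneg ht.1 fun r _ => hv0 r)] at this
  · rw [uIcc_of_ge hab] at h
    rw [abs_of_nonpos (by linarith)]
    have := le_mul_exp_of_le_add_integral (v := fun t => v (-t)) (by fun_prop) hL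
      (neg_le_neg hab) fun t ht => by
        have h1 := h (-t) ⟨by linarith [ht.2], by linarith [ht.1]⟩
        have h2 : ∫ r in a..(-t), v r = -∫ r in (-a)..t, v (-r) := by
          rw [intervalIntegral.integral_comp_neg, neg_neg, intervalIntegral.integral_symm]
        rw [h2, abs_neg, abs_of_nonneg (intervalIntegral.integral_nonneg ht.1 fun r _ => hv0 _)]
          at h1
        simpa using h1
    simp only [neg_neg] at this
    convert this using 3
    ring

end Gronwall

/-! ### The right-hand side of the system seen through the embedding -/

section Velocity

open scoped NNReal

variable {d m : ℕ} {M : Type*} [MetricSpace M] [ChartedSpace (EuclideanSpace ℝ (Fin d)) M]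
  {E : Type*} [NormedAddCommGroup E] [NormedSpace ℝ E]

/-- The derivative of `F` in direction of a vector field. -/
def pushField (F : M → E) (X : (x : M) → TangentSpace (𝓡 d) x) (x : M) : E :=
  mfderiv (𝓡 d) 𝓘(ℝ, E) F x (X x)

/-- The derivative of `F` in direction of the right-hand side of the control system for the
control value `w`. -/
def pushVelocity (F : M → E) (f₀ : (x : M) → TangentSpace (𝓡 d) x)
    (f : Fin m → (x : M) → TangentSpace (𝓡 d) x) (w : EuclideanSpace ℝ (Fin m)) (x : M) : E :=
  pushField F f₀ x + ∑ i, w i • pushField F (f i) x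

theorem pushVelocity_eq (F : M → E) (f₀ : (x : M) → TangentSpace (𝓡 d) x)
    (f : Fin m → (x : M) → TangentSpace (𝓡 d) x) (w : EuclideanSpace ℝ (Fin m)) (x : M) :
    pushVelocity F f₀ f w x =
      mfderiv (𝓡 d) 𝓘(ℝ, E) F x (f₀ x + ∑ i, w i • f i x) := by
  rw [map_add, map_sum]
  simp only [map_smul]
  rfl

/-- `pushField F X` is the fiber component of the tangent map of `F` composed with `X`; its `C¹`
regularity is what yields Lipschitz bounds in terms of `F`. -/
theorem contMDiff_pushField [IsManifold (𝓡 d) ∞ M] {F : M → E}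
    (hF : ContMDiff (𝓡 d) 𝓘(ℝ, E) ∞ F) {X : (x : M) → TangentSpace (𝓡 d) x}
    (hX : ContMDiff (𝓡 d) (𝓡 d).tangent 2 (fun x => (⟨x, X x⟩ : TangentBundle (𝓡 d) M))) :
    ContMDiff (𝓡 d) 𝓘(ℝ, E) 1 (pushField F X) := by
  have h1 : ContMDiff (𝓡 d).tangent 𝓘(ℝ, E).tangent 1 (tangentMap (𝓡 d) 𝓘(ℝ, E) F) :=
    hF.contMDiff_tangentMap (by norm_cast)
  exact (contMDiff_snd_tangentBundle_modelSpace E 𝓘(ℝ, E)).comp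
    (h1.comp (hX.of_le (by norm_num)))

theorem exists_norm_pushVelocity_le [IsManifold (𝓡 d) ∞ M] {F : M → E}
    (hF : ContMDiff (𝓡 d) 𝓘(ℝ, E) ∞ F) {f₀ : (x : M) → TangentSpace (𝓡 d) x}
    {f : Fin m → (x : M) → TangentSpace (𝓡 d) x}
    (hf₀ : ContMDiff (𝓡 d) (𝓡 d).tangent 2 (fun x => (⟨x, f₀ x⟩ : TangentBundle (𝓡 d) M)))
    (hf : ∀ i, ContMDiff (𝓡 d) (𝓡 d).tangent 2
      (fun x => (⟨x, f i x⟩ : TangentBundle (𝓡 d) M)))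
    {Q : Set M} (hQ : IsCompact Q) (C : ℝ) :
    ∃ B : ℝ, 0 ≤ B ∧ ∀ w : EuclideanSpace ℝ (Fin m), ‖w‖ ≤ C → ∀ x ∈ Q,
      ‖pushVelocity F f₀ f w x‖ ≤ B := by
  obtain ⟨B₀, hB₀⟩ := hQ.exists_bound_of_continuousOn
    (contMDiff_pushField hF hf₀).continuous.continuousOn
  have := fun i => hQ.exists_bound_of_continuousOn
    (contMDiff_pushField hF (hf i)).continuous.continuousOn
  choose B hB using this
  refine ⟨|B₀| + ∑ i, |C| * |B i|, by positivity, fun w hw x hx => ?_⟩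
  refine (norm_add_le _ _).trans (add_le_add ((hB₀ x hx).trans (le_abs_self _)) ?_)
  refine (norm_sum_le _ _).trans (Finset.sum_le_sum fun i _ => ?_)
  rw [norm_smul]
  exact mul_le_mul ((PiLp.norm_apply_le w i).trans (hw.trans (le_abs_self _)))
    ((hB i x hx).trans (le_abs_self _)) (norm_nonneg _) (abs_nonneg _)

theorem IsEmbeddingNear.exists_norm_pushVelocity_sub_le [IsManifold (𝓡 d) ∞ M] {F : M → E}
    {Q : Set M} (hF : IsEmbeddingNear d Q F) {f₀ : (x : M) → TangentSpace (𝓡 d) x}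
    {f : Fin m → (x : M) → TangentSpace (𝓡 d) x}
    (hf₀ : ContMDiff (𝓡 d) (𝓡 d).tangent 2 (fun x => (⟨x, f₀ x⟩ : TangentBundle (𝓡 d) M)))
    (hf : ∀ i, ContMDiff (𝓡 d) (𝓡 d).tangent 2
      (fun x => (⟨x, f i x⟩ : TangentBundle (𝓡 d) M)))
    (hQ : IsCompact Q) (C : ℝ) :
    ∃ L : ℝ, 0 ≤ L ∧ ∀ w : EuclideanSpace ℝ (Fin m), ‖w‖ ≤ C → ∀ x ∈ Q, ∀ y ∈ Q,
      ‖pushVelocity F f₀ f w x - pushVelocity F f₀ f w y‖ ≤ L * ‖F x - F y‖ := by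
  obtain ⟨L₀, hL₀, h₀⟩ := hF.exists_norm_sub_le hQ (contMDiff_pushField hF.contMDiff hf₀)
  have := fun i => hF.exists_norm_sub_le hQ (contMDiff_pushField hF.contMDiff (hf i))
  choose L hL h using this
  refine ⟨L₀ + ∑ i, |C| * L i, add_nonneg hL₀ (Finset.sum_nonneg fun i _ =>
    mul_nonneg (abs_nonneg _) (hL i)), fun w hw x hx y hy => ?_⟩
  have heq : pushVelocity F f₀ f w x - pushVelocity F f₀ f w y =
      (pushField F f₀ x - pushField F f₀ y) +
        ∑ i, w i • (pushField F (f i) x - pushField F (f i) y) := by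
    simp only [pushVelocity, smul_sub, Finset.sum_sub_distrib]
    abel
  rw [heq, add_mul, Finset.sum_mul]
  refine (norm_add_le _ _).trans (add_le_add (h₀ x hx y hy) ?_)
  refine (norm_sum_le _ _).trans (Finset.sum_le_sum fun i _ => ?_)
  rw [norm_smul, mul_assoc]
  exact mul_le_mul ((PiLp.norm_apply_le w i).trans (hw.trans (le_abs_self _)))
    (h i x hx y hy) (norm_nonneg _) (abs_nonneg _)

end Velocity

/-! ### The integral equation and exponential divergence of trajectories -/

section Trajectory

open scoped NNReal

variable {d m : ℕ} {M : Type*} [MetricSpace M] [ChartedSpace (EuclideanSpace ℝ (Fin d)) M]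
  {E : Type*} [NormedAddCommGroup E] [NormedSpace ℝ E]
  {f₀ : (x : M) → TangentSpace (𝓡 d) x} {f : Fin m → (x : M) → TangentSpace (𝓡 d) x}
  {U : Set (EuclideanSpace ℝ (Fin m))}

theorem uniformContinuousOn_of_absolutelyContinuousOnInterval {X : Type*} [PseudoMetricSpace X]
    {γ : ℝ → X} {a b : ℝ} (h : AbsolutelyContinuousOnInterval γ a b) :
    UniformContinuousOn γ (uIcc a b) := by
  rw [absolutelyContinuousOnInterval_iff] at h
  rw [Metric.uniformContinuousOn_iff]
  intro ε hε
  obtain ⟨δ, hδ, h⟩ := h ε hε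
  refine ⟨δ, hδ, fun x hx y hy hxy => ?_⟩
  -- Absolute continuity tested on the single interval from `x` to `y`.
  simpa using h (1, fun _ => (x, y)) ⟨by simpa using ⟨hx, hy⟩, by simp⟩ (by simpa using hxy)

theorem IsTrajectory.continuous {u : Control U} {γ : ℝ → M} (hγ : IsTrajectory f₀ f u γ) :
    Continuous γ := by
  refine continuous_iff_continuousAt.2 fun t => ?_
  refine (uniformContinuousOn_of_absolutelyContinuousOnInterval
    (hγ.1 (t - 1) (t + 1))).continuousOn.continuousAt ?_
  rw [uIcc_of_le (by linarith)]
  exact Icc_mem_nhds (by linarith) (by linarith)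

theorem absolutelyContinuousOnInterval_comp_lipschitz {X Y : Type*} [PseudoMetricSpace X]
    [PseudoMetricSpace Y] {F : X → Y} {C : ℝ≥0} (hF : LipschitzWith C F) {γ : ℝ → X} {a b : ℝ}
    (hγ : AbsolutelyContinuousOnInterval γ a b) :
    AbsolutelyContinuousOnInterval (F ∘ γ) a b := by
  rw [absolutelyContinuousOnInterval_iff] at hγ ⊢
  intro ε hε
  obtain ⟨δ, hδ, h⟩ := hγ (ε / (C + 1)) (by positivity)
  refine ⟨δ, hδ, fun I hI hlen => ?_⟩
  have h1 := h I hI hlen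
  rw [lt_div_iff₀ (by positivity)] at h1
  calc ∑ i ∈ Finset.range I.1, dist ((F ∘ γ) (I.2 i).1) ((F ∘ γ) (I.2 i).2)
      ≤ ∑ i ∈ Finset.range I.1, C * dist (γ (I.2 i).1) (γ (I.2 i).2) :=
        Finset.sum_le_sum fun i _ => hF.dist_le_mul _ _
    _ = (∑ i ∈ Finset.range I.1, dist (γ (I.2 i).1) (γ (I.2 i).2)) * C := by
        rw [← Finset.mul_sum, mul_comm]
    _ ≤ (∑ i ∈ Finset.range I.1, dist (γ (I.2 i).1) (γ (I.2 i).2)) * (C + 1) :=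
        mul_le_mul_of_nonneg_left (by linarith) (Finset.sum_nonneg fun _ _ => dist_nonneg)
    _ < ε := h1

theorem hasDerivAt_comp_of_hasMFDerivAt {F : M → E} {γ : ℝ → M} {t : ℝ}
    {v : TangentSpace (𝓡 d) (γ t)} (hF : MDifferentiableAt (𝓡 d) 𝓘(ℝ, E) F (γ t))
    (hγ : HasMFDerivAt 𝓘(ℝ, ℝ) (𝓡 d) γ t ((1 : ℝ →L[ℝ] ℝ).smulRight v)) :
    HasDerivAt (F ∘ γ) (show E from mfderiv (𝓡 d) 𝓘(ℝ, E) F (γ t) v) t := by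
  have h : HasFDerivAt (F ∘ γ) (show ℝ →L[ℝ] E from (mfderiv (𝓡 d) 𝓘(ℝ, E) F (γ t)).comp
      ((1 : ℝ →L[ℝ] ℝ).smulRight v)) t := (hF.hasMFDerivAt.comp t hγ).hasFDerivAt
  have h2 : HasDerivAt (F ∘ γ) (show E from mfderiv (𝓡 d) 𝓘(ℝ, E) F (γ t) ((1 : ℝ) • v)) t :=
    h.hasDerivAt
  rwa [one_smul] at h2

variable [IsManifold (𝓡 d) ∞ M]

theorem intervalIntegrable_pushVelocity {F : M → E}
    (hF : ContMDiff (𝓡 d) 𝓘(ℝ, E) ∞ F)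
    (hf₀ : ContMDiff (𝓡 d) (𝓡 d).tangent 2 (fun x => (⟨x, f₀ x⟩ : TangentBundle (𝓡 d) M)))
    (hf : ∀ i, ContMDiff (𝓡 d) (𝓡 d).tangent 2
      (fun x => (⟨x, f i x⟩ : TangentBundle (𝓡 d) M)))
    (hU : IsCompact U) (u : Control U) {γ : ℝ → M} (hγ : Continuous γ) (a b : ℝ) :
    IntervalIntegrable (fun t => pushVelocity F f₀ f (u.toFun t) (γ t)) volume a b := by
  obtain ⟨C, -, hC⟩ := Control.exists_ae_norm_le hU
  have hu : ∀ i, IntervalIntegrable (fun t => u.toFun t i) volume a b := by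
    intro i
    refine intervalIntegrable_of_ae_norm_le (C := C)
      ((EuclideanSpace.proj i : EuclideanSpace ℝ (Fin m) →L[ℝ] ℝ).measurable.comp
        u.measurable_toFun) ?_ a b
    filter_upwards [hC u] with t ht using (PiLp.norm_apply_le _ i).trans ht
  refine IntervalIntegrable.add
    (((contMDiff_pushField hF hf₀).continuous.comp hγ).intervalIntegrable a b) ?_
  have := IntervalIntegrable.sum (μ := volume) (a := a) (b := b) Finset.univ
    (f := fun i t => u.toFun t i • pushField F (f i) (γ t)) fun i _ =>
      (hu i).smul_continuousOn ((contMDiff_pushField hF (hf i)).continuous.comp hγ).continuousOn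
  refine this.congr fun t _ => ?_
  simp

variable [CompleteSpace E]

/-- Both sides are absolutely continuous in the endpoint with the same derivative almost everywhere:
the left because `F` is Lipschitz, the right because the velocity is bounded along the compact arc.
-/
theorem IsTrajectory.sub_eq_integral {F : M → E}
    (hF : ContMDiff (𝓡 d) 𝓘(ℝ, E) ∞ F) {C : ℝ≥0} (hFC : LipschitzWith C F)
    (hf₀ : ContMDiff (𝓡 d) (𝓡 d).tangent 2 (fun x => (⟨x, f₀ x⟩ : TangentBundle (𝓡 d) M)))
    (hf : ∀ i, ContMDiff (𝓡 d) (𝓡 d).tangent 2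
      (fun x => (⟨x, f i x⟩ : TangentBundle (𝓡 d) M)))
    (hU : IsCompact U) {u : Control U} {γ : ℝ → M} (hγ : IsTrajectory f₀ f u γ) (a b : ℝ) :
    F (γ b) - F (γ a) = ∫ t in a..b, pushVelocity F f₀ f (u.toFun t) (γ t) := by
  obtain ⟨C', -, hC'⟩ := Control.exists_ae_norm_le hU
  obtain ⟨B, hB, hBbd⟩ := exists_norm_pushVelocity_le hF hf₀ hf
    (isCompact_uIcc.image hγ.continuous (s := uIcc a b)) C'
  have hint := intervalIntegrable_pushVelocity hF hf₀ hf hU u hγ.continuous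
  have hlip : LipschitzOnWith B.toNNReal
      (fun x => ∫ t in a..x, pushVelocity F f₀ f (u.toFun t) (γ t)) (uIcc a b) := by
    refine LipschitzOnWith.of_dist_le_mul fun y hy x hx => ?_
    rw [Real.coe_toNNReal B hB, dist_eq_norm, Real.dist_eq,
      intervalIntegral.integral_interval_sub_left (hint _ _) (hint _ _)]
    refine intervalIntegral.norm_integral_le_of_norm_le_const_ae ?_
    filter_upwards [hC' u] with t ht hmem
    exact hBbd _ ht _ ⟨t, uIcc_subset_uIcc hx hy (uIoc_subset_uIcc hmem), rfl⟩
  have hac := (absolutelyContinuousOnInterval_comp_lipschitz hFC (hγ.1 a b)).sub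
    hlip.absolutelyContinuousOnInterval
  obtain ⟨c, hc⟩ := hac.const_of_ae_hasDerivAt_zero (by
    filter_upwards [hγ.2, (hint a b).ae_hasDerivAt_integral] with t ht1 ht2 hmem
    have h1 := hasDerivAt_comp_of_hasMFDerivAt
      (hF.mdifferentiable (by simp) (γ t)) ht1
    have h3 := h1.sub (ht2 hmem a left_mem_uIcc)
    rw [pushVelocity_eq] at h3
    rw [show (show E from mfderiv (𝓡 d) 𝓘(ℝ, E) F (γ t)
      (f₀ (γ t) + ∑ i, u.toFun t i • f i (γ t))) - _ = 0 from sub_self _] at h3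
    exact h3)
  have h1 := hc a left_mem_uIcc
  have h2 := hc b right_mem_uIcc
  simp only [Pi.sub_apply, Function.comp, intervalIntegral.integral_same, sub_zero] at h1 h2
  rw [h1, ← h2]
  abel

/-- Trajectories in a compact set diverge at most exponentially, as seen through an embedding. -/
theorem IsEmbeddingNear.exists_norm_sub_le_exp {F : M → E} {Q : Set M} (hQ : IsCompact Q)
    (hF : IsEmbeddingNear d Q F)
    (hf₀ : ContMDiff (𝓡 d) (𝓡 d).tangent 2 (fun x => (⟨x, f₀ x⟩ : TangentBundle (𝓡 d) M)))
    (hf : ∀ i, ContMDiff (𝓡 d) (𝓡 d).tangent 2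
      (fun x => (⟨x, f i x⟩ : TangentBundle (𝓡 d) M)))
    (hU : IsCompact U) :
    ∃ L : ℝ, 0 ≤ L ∧ ∀ (u : Control U) (γ₁ γ₂ : ℝ → M), IsTrajectory f₀ f u γ₁ →
      IsTrajectory f₀ f u γ₂ → ∀ a b : ℝ, (∀ t ∈ uIcc a b, γ₁ t ∈ Q) →
      (∀ t ∈ uIcc a b, γ₂ t ∈ Q) →
      ‖F (γ₁ b) - F (γ₂ b)‖ ≤ ‖F (γ₁ a) - F (γ₂ a)‖ * Real.exp (L * |b - a|) := by
  obtain ⟨C, -, hC⟩ := Control.exists_ae_norm_le hU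
  obtain ⟨L, hL, hLip⟩ := hF.exists_norm_pushVelocity_sub_le hf₀ hf hQ C
  obtain ⟨K, hK⟩ := hF.exists_lipschitzWith
  refine ⟨L, hL, fun u γ₁ γ₂ h₁ h₂ a b hQ₁ hQ₂ => ?_⟩
  have hFc := hF.contMDiff.continuous
  have hcont : Continuous fun t => ‖F (γ₁ t) - F (γ₂ t)‖ :=
    ((hFc.comp h₁.continuous).sub (hFc.comp h₂.continuous)).norm
  refine le_mul_exp_of_le_add_abs_integral hcont (fun t => norm_nonneg _) hL fun t ht => ?_
  have e₁ := h₁.sub_eq_integral hF.contMDiff hK hf₀ hf hU a t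
  have e₂ := h₂.sub_eq_integral hF.contMDiff hK hf₀ hf hU a t
  have e : F (γ₁ t) - F (γ₂ t) = (F (γ₁ a) - F (γ₂ a)) +
      ∫ r in a..t, (pushVelocity F f₀ f (u.toFun r) (γ₁ r) -
        pushVelocity F f₀ f (u.toFun r) (γ₂ r)) := by
    rw [intervalIntegral.integral_sub
      (intervalIntegrable_pushVelocity hF.contMDiff hf₀ hf hU u h₁.continuous a t)
      (intervalIntegrable_pushVelocity hF.contMDiff hf₀ hf hU u h₂.continuous a t), ← e₁, ← e₂]
    abel
  rw [e]
  refine (norm_add_le _ _).trans (add_le_add_right ?_ _)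
  rw [show L * |∫ r in a..t, ‖F (γ₁ r) - F (γ₂ r)‖| = |L * ∫ r in a..t, ‖F (γ₁ r) - F (γ₂ r)‖| by
    rw [abs_mul, abs_of_nonneg hL], ← intervalIntegral.integral_const_mul]
  refine intervalIntegral.norm_integral_le_abs_of_norm_le ?_
    ((hcont.const_mul L).intervalIntegrable a t)
  refine (ae_restrict_iff' measurableSet_uIoc).2 ?_
  filter_upwards [hC u] with r hr hmem
  have hmem' : r ∈ uIcc a b := uIcc_subset_uIcc left_mem_uIcc ht (uIoc_subset_uIcc hmem)
  exact hLip _ hr _ (hQ₁ r hmem') _ (hQ₂ r hmem')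

end Trajectory

/-! ### Time shifts -/

section Shift

variable {d m : ℕ} {M : Type*} [MetricSpace M] [ChartedSpace (EuclideanSpace ℝ (Fin d)) M]
  {f₀ : (x : M) → TangentSpace (𝓡 d) x} {f : Fin m → (x : M) → TangentSpace (𝓡 d) x}
  {U : Set (EuclideanSpace ℝ (Fin m))}

theorem absolutelyContinuousOnInterval_comp_add {X : Type*} [PseudoMetricSpace X] {γ : ℝ → X}
    {a b : ℝ} (s : ℝ) (h : AbsolutelyContinuousOnInterval γ (a + s) (b + s)) :
    AbsolutelyContinuousOnInterval (fun t => γ (t + s)) a b := by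
  rw [absolutelyContinuousOnInterval_iff] at h ⊢
  intro ε hε
  obtain ⟨δ, hδ, h⟩ := h ε hε
  refine ⟨δ, hδ, fun I hI hlen => ?_⟩
  have hu : ∀ x y t : ℝ, t + s ∈ uIcc (x + s) (y + s) ↔ t ∈ uIcc x y := by
    intro x y t
    simp only [mem_uIcc, add_le_add_iff_right]
  refine h (I.1, fun i => ((I.2 i).1 + s, (I.2 i).2 + s)) ⟨fun i hi => ?_, fun i hi j hj hij => ?_⟩
    (by simpa using hlen)
  · exact ⟨(hu _ _ _).2 (hI.1 i hi).1, (hu _ _ _).2 (hI.1 i hi).2⟩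
  · have hdis := hI.2 hi hj hij
    simp only [Function.onFun, Set.disjoint_left, mem_uIoc] at hdis ⊢
    intro t ht ht'
    refine hdis (a := t - s) ?_ ?_
    · rcases ht with ht | ht
      · exact Or.inl ⟨by linarith [ht.1], by linarith [ht.2]⟩
      · exact Or.inr ⟨by linarith [ht.1], by linarith [ht.2]⟩
    · rcases ht' with ht | ht
      · exact Or.inl ⟨by linarith [ht.1], by linarith [ht.2]⟩
      · exact Or.inr ⟨by linarith [ht.1], by linarith [ht.2]⟩

theorem IsTrajectory.shift {u : Control U} {γ : ℝ → M} (hγ : IsTrajectory f₀ f u γ) (s : ℝ) :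
    IsTrajectory f₀ f (u.shift s) (fun t => γ (t + s)) := by
  refine ⟨fun a b => absolutelyContinuousOnInterval_comp_add s (hγ.1 _ _), ?_⟩
  filter_upwards [(measurePreserving_add_right volume s).quasiMeasurePreserving.ae hγ.2] with t ht
  have h1 : HasMFDerivAt 𝓘(ℝ, ℝ) 𝓘(ℝ, ℝ) (fun t : ℝ => t + s) t (ContinuousLinearMap.id ℝ ℝ) :=
    ((hasFDerivAt_id t).add_const s).hasMFDerivAt
  exact ht.comp t h1

theorem Control.shift_shift (u : Control U) (r s : ℝ) : (u.shift s).shift r = u.shift (r + s) := by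
  simp only [Control.shift, add_assoc]

end Shift

/-! ### Returning from the embedding to the manifold -/

section LeftInverse

variable {d : ℕ} {M : Type*} [MetricSpace M] [ChartedSpace (EuclideanSpace ℝ (Fin d)) M]
  {E : Type*} [NormedAddCommGroup E] [NormedSpace ℝ E]

/-- Near `t` one has `γ = G ∘ (F ∘ γ)`, and the chain rule for `G ∘ F = id` shows that `dG` sends
`dF v` back to `v`. -/
theorem hasMFDerivAt_of_leftInverse {F : M → E} {G : E → M} {γ : ℝ → M} {t : ℝ}
    {v : TangentSpace (𝓡 d) (γ t)} (hF : MDifferentiableAt (𝓡 d) 𝓘(ℝ, E) F (γ t))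
    (hG : MDifferentiableAt 𝓘(ℝ, E) (𝓡 d) G (F (γ t))) (hGF : ∀ᶠ x in 𝓝 (γ t), G (F x) = x)
    (hγ : ContinuousAt γ t)
    (h : HasDerivAt (F ∘ γ) (show E from mfderiv (𝓡 d) 𝓘(ℝ, E) F (γ t) v) t) :
    HasMFDerivAt 𝓘(ℝ, ℝ) (𝓡 d) γ t ((1 : ℝ →L[ℝ] ℝ).smulRight v) := by
  have hid : HasMFDerivAt (𝓡 d) (𝓡 d) id (γ t)
      ((mfderiv 𝓘(ℝ, E) (𝓡 d) G (F (γ t))).comp (mfderiv (𝓡 d) 𝓘(ℝ, E) F (γ t))) :=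
    (hG.hasMFDerivAt.comp (γ t) hF.hasMFDerivAt).congr_of_eventuallyEq
      (hGF.mono fun x hx => hx.symm)
  have huniq := hasMFDerivAt_unique hid (hasMFDerivAt_id (γ t))
  have hv := congr($huniq v)
  have hd : HasMFDerivAt 𝓘(ℝ, ℝ) 𝓘(ℝ, E) (F ∘ γ) t
      ((1 : ℝ →L[ℝ] ℝ).smulRight (show E from mfderiv (𝓡 d) 𝓘(ℝ, E) F (γ t) v)) :=
    h.hasFDerivAt.hasMFDerivAt
  have hcomp := (hG.hasMFDerivAt.comp t hd).congr_of_eventuallyEq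
    (f₁ := γ) ((hγ.eventually hGF).mono fun r hr => hr.symm)
  refine HasMFDerivAt.congr_mfderiv hcomp ?_
  ext1
  have h1 : (1 : ℝ) • (show E from mfderiv (𝓡 d) 𝓘(ℝ, E) F (γ t) v) =
      mfderiv (𝓡 d) 𝓘(ℝ, E) F (γ t) v := one_smul _ _
  have h2 : (1 : ℝ) • v = v := one_smul _ _
  exact (congrArg (mfderiv 𝓘(ℝ, E) (𝓡 d) G (F (γ t))) h1).trans (hv.trans h2.symm)

end LeftInverse

/-! ### Uniqueness, the cocycle property, and limits of trajectories -/

section Flow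

variable {d m : ℕ} {M : Type*} [MetricSpace M] [ChartedSpace (EuclideanSpace ℝ (Fin d)) M]
  [IsManifold (𝓡 d) ∞ M]
  [Bundle.RiemannianBundle (fun x : M => TangentSpace (𝓡 d) x)]
  [IsContMDiffRiemannianBundle (𝓡 d) ∞ (EuclideanSpace ℝ (Fin d))
      (fun x : M => TangentSpace (𝓡 d) x)]
  [IsRiemannianManifold (𝓡 d) M]
  {f₀ : (x : M) → TangentSpace (𝓡 d) x} {f : Fin m → (x : M) → TangentSpace (𝓡 d) x}
  {U : Set (EuclideanSpace ℝ (Fin m))}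

/-- Grönwall with initial difference zero, using an embedding near the two compact arcs. -/
theorem IsTrajectory.eq_of_eq_zero
    (hf₀ : ContMDiff (𝓡 d) (𝓡 d).tangent 2 (fun x => (⟨x, f₀ x⟩ : TangentBundle (𝓡 d) M)))
    (hf : ∀ i, ContMDiff (𝓡 d) (𝓡 d).tangent 2
      (fun x => (⟨x, f i x⟩ : TangentBundle (𝓡 d) M)))
    (hU : IsCompact U) {u : Control U} {γ₁ γ₂ : ℝ → M} (h₁ : IsTrajectory f₀ f u γ₁)
    (h₂ : IsTrajectory f₀ f u γ₂) (h0 : γ₁ 0 = γ₂ 0) : γ₁ = γ₂ := by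
  ext t
  have hQ : IsCompact (γ₁ '' uIcc 0 t ∪ γ₂ '' uIcc 0 t) :=
    (isCompact_uIcc.image h₁.continuous).union (isCompact_uIcc.image h₂.continuous)
  obtain ⟨s, F, hF⟩ := exists_isEmbeddingNear (d := d) hQ
  obtain ⟨L, -, h⟩ := hF.exists_norm_sub_le_exp hQ hf₀ hf hU
  have := h u γ₁ γ₂ h₁ h₂ 0 t (fun r hr => Or.inl ⟨r, hr, rfl⟩) (fun r hr => Or.inr ⟨r, hr, rfl⟩)
  rw [h0, sub_self, norm_zero, zero_mul] at this
  refine hF.injOn (Or.inl ⟨t, right_mem_uIcc, rfl⟩) (Or.inr ⟨t, right_mem_uIcc, rfl⟩) ?_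
  exact sub_eq_zero.1 (norm_le_zero_iff.1 this)

omit [IsManifold (𝓡 d) ∞ M] [Bundle.RiemannianBundle (fun x : M => TangentSpace (𝓡 d) x)]
  [IsContMDiffRiemannianBundle (𝓡 d) ∞ (EuclideanSpace ℝ (Fin d))
      (fun x : M => TangentSpace (𝓡 d) x)]
  [IsRiemannianManifold (𝓡 d) M] in
theorem isTrajectory_flow (hc : IsComplete f₀ f U) (x : M) (u : Control U) :
    IsTrajectory f₀ f u (fun t => flow f₀ f t x u) ∧ flow f₀ f 0 x u = x := by
  have h := hc u x
  have heq : (fun t => flow f₀ f t x u) = h.choose := by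
    ext t
    rw [flow, dif_pos h]
  exact ⟨heq ▸ h.choose_spec.1, (congr_fun heq 0).trans h.choose_spec.2⟩

theorem IsTrajectory.eq_flow (hc : IsComplete f₀ f U)
    (hf₀ : ContMDiff (𝓡 d) (𝓡 d).tangent 2 (fun x => (⟨x, f₀ x⟩ : TangentBundle (𝓡 d) M)))
    (hf : ∀ i, ContMDiff (𝓡 d) (𝓡 d).tangent 2
      (fun x => (⟨x, f i x⟩ : TangentBundle (𝓡 d) M)))
    (hU : IsCompact U) {u : Control U} {γ : ℝ → M} (h : IsTrajectory f₀ f u γ) (t : ℝ) :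
    γ t = flow f₀ f t (γ 0) u :=
  congr_fun (h.eq_of_eq_zero hf₀ hf hU (isTrajectory_flow hc (γ 0) u).1
    (isTrajectory_flow hc (γ 0) u).2.symm) t

theorem flow_flow (hc : IsComplete f₀ f U)
    (hf₀ : ContMDiff (𝓡 d) (𝓡 d).tangent 2 (fun x => (⟨x, f₀ x⟩ : TangentBundle (𝓡 d) M)))
    (hf : ∀ i, ContMDiff (𝓡 d) (𝓡 d).tangent 2
      (fun x => (⟨x, f i x⟩ : TangentBundle (𝓡 d) M)))
    (hU : IsCompact U) (u : Control U) (x : M) (r s : ℝ) :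
    flow f₀ f r (flow f₀ f s x u) (u.shift s) = flow f₀ f (r + s) x u := by
  have := (((isTrajectory_flow hc x u).1.shift s).eq_flow hc hf₀ hf hU r).symm
  simpa using this

/-- A pointwise limit of trajectories that stay in a compact set for longer and longer times is a
trajectory for the limit of the controls. -/
theorem exists_isTrajectory_of_tendsto {α : Type*} (l : Ultrafilter α) {Q : Set M}
    (hQ : IsCompact Q)
    (hf₀ : ContMDiff (𝓡 d) (𝓡 d).tangent 2 (fun x => (⟨x, f₀ x⟩ : TangentBundle (𝓡 d) M)))
    (hf : ∀ i, ContMDiff (𝓡 d) (𝓡 d).tangent 2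
      (fun x => (⟨x, f i x⟩ : TangentBundle (𝓡 d) M)))
    (hU : IsCompact U) {v : α → Control U} {u : Control U} (hv : Tendsto v l (𝓝 u))
    {γ : α → ℝ → M} (hγ : ∀ n, IsTrajectory f₀ f (v n) (γ n))
    (hγQ : ∀ T : ℝ, ∀ᶠ n in l, ∀ t ∈ Icc (-T) T, γ n t ∈ Q) :
    ∃ η : ℝ → M, IsTrajectory f₀ f u η ∧ (∀ t, η t ∈ Q) ∧
      ∀ t, Tendsto (fun n => γ n t) l (𝓝 (η t)) := by
  have hmemt : ∀ t, ∀ᶠ n in l, γ n t ∈ Q := fun t =>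
    (hγQ |t|).mono fun n hn => hn t (abs_le.1 le_rfl)
  have hmem : ∀ a b : ℝ, ∀ᶠ n in l, ∀ t ∈ uIcc a b, γ n t ∈ Q := by
    intro a b
    refine (hγQ (max |a| |b|)).mono fun n hn t ht => hn t (abs_le.1 ?_)
    exact abs_le_max_abs_abs ht.1 ht.2 |>.trans (by
      rcases le_total a b with h | h <;> simp [h, max_comm])
  have ex : ∀ t, ∃ q ∈ Q, Tendsto (fun n => γ n t) l (𝓝 q) := fun t =>
    hQ.ultrafilter_le_nhds (l.map fun n => γ n t) (le_principal_iff.2 (hmemt t))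
  choose η hηQ hη using ex
  obtain ⟨s, F, hF⟩ := exists_isEmbeddingNear (d := d) hQ
  obtain ⟨K, hK⟩ := hF.exists_lipschitzWith
  obtain ⟨C, -, hC⟩ := Control.exists_ae_norm_le hU
  obtain ⟨B, hB0, hB⟩ := exists_norm_pushVelocity_le hF.contMDiff hf₀ hf hQ C
  obtain ⟨L, hL0, hL⟩ := hF.exists_norm_pushVelocity_sub_le hf₀ hf hQ C
  obtain ⟨D, hD0, hD⟩ := hF.exists_dist_le hQ
  have hFc := hF.contMDiff.continuous
  have hFη : ∀ t, Tendsto (fun n => F (γ n t)) l (𝓝 (F (η t))) := fun t =>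
    (hFc.tendsto _).comp (hη t)
  -- The bounded velocity makes the approximants equi-Lipschitz in `E`; this passes to `η` and
  -- upgrades pointwise to locally uniform convergence.
  have hlipn : ∀ a b : ℝ, ∀ᶠ n in l, ∀ x ∈ uIcc a b, ∀ y ∈ uIcc a b,
      ‖F (γ n y) - F (γ n x)‖ ≤ B * |y - x| := by
    intro a b
    filter_upwards [hmem a b] with n hn x hx y hy
    rw [(hγ n).sub_eq_integral hF.contMDiff hK hf₀ hf hU]
    refine intervalIntegral.norm_integral_le_of_norm_le_const_ae ?_
    filter_upwards [hC (v n)] with t ht ht'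
    exact hB _ ht _ (hn t (uIcc_subset_uIcc hx hy (uIoc_subset_uIcc ht')))
  have hlip : ∀ x y, ‖F (η y) - F (η x)‖ ≤ B * |y - x| := fun x y =>
    le_of_tendsto ((hFη y).sub (hFη x)).norm
      ((hlipn x y).mono fun n hn => hn x left_mem_uIcc y right_mem_uIcc)
  have hηlip : LipschitzWith (D * B).toNNReal η := by
    refine LipschitzWith.of_dist_le_mul fun y x => ?_
    rw [Real.coe_toNNReal _ (mul_nonneg hD0 hB0), mul_assoc, Real.dist_eq]
    exact (hD _ (hηQ y) _ (hηQ x)).trans (mul_le_mul_of_nonneg_left (hlip x y) hD0)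
  have hηc := hηlip.continuous
  have hunif : ∀ a b ε : ℝ, 0 < ε → ∀ᶠ n in l, ∀ t ∈ uIcc a b, ‖F (γ n t) - F (η t)‖ ≤ ε := by
    intro a b ε hε
    refine (isCompact_uIcc (a := a) (b := b)).induction_on
      (p := fun s => ∀ᶠ n in l, ∀ t ∈ s, ‖F (γ n t) - F (η t)‖ ≤ ε) (by simp) ?_ ?_ ?_
    · intro s t hst h
      exact h.mono fun n hn r hr => hn r (hst hr)
    · intro s t hs ht
      filter_upwards [hs, ht] with n h1 h2 r hr using hr.elim (h1 r) (h2 r)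
    · intro t ht
      have hδ : 0 < ε / (3 * (B + 1)) := by positivity
      refine ⟨uIcc a b ∩ Metric.ball t (ε / (3 * (B + 1))),
        inter_mem self_mem_nhdsWithin (nhdsWithin_le_nhds (Metric.ball_mem_nhds _ hδ)), ?_⟩
      filter_upwards [hlipn a b, Metric.tendsto_nhds.1 (hFη t) (ε / 3) (by positivity)]
        with n h1 h2 r hr
      have hr2 : |r - t| ≤ ε / (3 * (B + 1)) := (Metric.mem_ball.1 hr.2).le
      have hBr : B * |r - t| ≤ ε / 3 := by
        calc B * |r - t| ≤ (B + 1) * (ε / (3 * (B + 1))) :=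
              mul_le_mul (by linarith) hr2 (abs_nonneg _) (by linarith)
          _ = ε / 3 := by field_simp
      have e1 := h1 t ht r hr.1
      have e2 := hlip t r
      rw [dist_eq_norm] at h2
      calc ‖F (γ n r) - F (η r)‖ = ‖(F (γ n r) - F (γ n t)) + (F (γ n t) - F (η t)) -
            (F (η r) - F (η t))‖ := by congr 1; abel
        _ ≤ ‖F (γ n r) - F (γ n t)‖ + ‖F (γ n t) - F (η t)‖ + ‖F (η r) - F (η t)‖ :=
            (norm_sub_le _ _).trans (add_le_add_left (norm_add_le _ _) _)
        _ ≤ ε := by linarith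
  have hint : ∀ (w : Control U) a b, IntervalIntegrable
      (fun t => pushVelocity F f₀ f (w.toFun t) (η t)) volume a b := fun w a b =>
    intervalIntegrable_pushVelocity hF.contMDiff hf₀ hf hU w hηc a b
  -- Locally uniform convergence allows `γ n` to be replaced by the limit `η` inside the velocity,
  -- leaving only the control dependent on `n`.
  have hdiff : ∀ a b, Tendsto (fun n => (F (γ n b) - F (γ n a)) -
      ∫ t in a..b, pushVelocity F f₀ f ((v n).toFun t) (η t)) l (𝓝 0) := by
    intro a b
    rw [Metric.tendsto_nhds]
    intro ε hε
    filter_upwards [hmem a b, hunif a b (ε / ((L + 1) * (|b - a| + 1))) (by positivity)]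
      with n hn hn'
    rw [dist_zero_right, (hγ n).sub_eq_integral hF.contMDiff hK hf₀ hf hU,
      ← intervalIntegral.integral_sub
        (intervalIntegrable_pushVelocity hF.contMDiff hf₀ hf hU (v n) (hγ n).continuous a b)
        (hint (v n) a b)]
    have hle := intervalIntegral.norm_integral_le_of_norm_le_const_ae (a := a) (b := b)
      (f := fun t => pushVelocity F f₀ f ((v n).toFun t) (γ n t) -
        pushVelocity F f₀ f ((v n).toFun t) (η t))
      (C := L * (ε / ((L + 1) * (|b - a| + 1)))) (by
        filter_upwards [hC (v n)] with t ht ht'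
        exact (hL _ ht _ (hn t (uIoc_subset_uIcc ht')) _ (hηQ t)).trans
          (mul_le_mul_of_nonneg_left (hn' t (uIoc_subset_uIcc ht')) hL0))
    refine hle.trans_lt ?_
    have hpos : 0 < (L + 1) * (|b - a| + 1) := by positivity
    rw [mul_div_assoc', div_mul_eq_mul_div, div_lt_iff₀ hpos]
    nlinarith [mul_nonneg hL0 hε.le, mul_nonneg hε.le (abs_nonneg (b - a))]
  -- With the state fixed along `η` the velocity is affine in the control, so after applying `φ` the
  -- control enters only through its pairing with the integrable function `g` cut off to `(a, b]`.
  -- This is where weak* convergence suffices.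
  have hweak : ∀ (φ : StrongDual ℝ (s → EuclideanSpace ℝ (Fin d) × ℝ)) a b, a ≤ b →
      Tendsto (fun n => φ (∫ t in a..b, pushVelocity F f₀ f ((v n).toFun t) (η t))) l
        (𝓝 (φ (∫ t in a..b, pushVelocity F f₀ f (u.toFun t) (η t)))) := by
    intro φ a b hab
    let g : ℝ → EuclideanSpace ℝ (Fin m) := fun t =>
      WithLp.toLp 2 fun i => φ (pushField F (f i) (η t))
    have hg0 : Continuous g := by
      refine (PiLp.continuous_toLp 2 _).comp (continuous_pi fun i => ?_)
      exact φ.continuous.comp ((contMDiff_pushField hF.contMDiff (hf i)).continuous.comp hηc)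
    have hgi : Integrable ((Ioc a b).indicator g) :=
      (integrable_indicator_iff measurableSet_Ioc).2
        ((hg0.integrableOn_Icc).mono_set Ioc_subset_Icc_self)
    have hkey : ∀ w : Control U, φ (∫ t in a..b, pushVelocity F f₀ f (w.toFun t) (η t)) =
        (∫ t in a..b, φ (pushField F f₀ (η t))) +
          ∫ t, inner ℝ (w.toFun t) ((Ioc a b).indicator g t) := by
      intro w
      have h0i : IntervalIntegrable (fun t => φ (pushField F f₀ (η t))) volume a b :=
        (φ.continuous.comp ((contMDiff_pushField hF.contMDiff hf₀).continuous.comp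
          hηc)).intervalIntegrable a b
      have hwi : IntervalIntegrable (fun t => inner ℝ (w.toFun t) (g t)) volume a b := by
        rw [intervalIntegrable_iff]
        exact integrable_inner_of_ae_norm_le w.measurable_toFun (ae_restrict_of_ae (hC w))
          (hg0.intervalIntegrable a b).def'
      have e1 : ∫ t, inner ℝ (w.toFun t) ((Ioc a b).indicator g t) =
          ∫ t in a..b, inner ℝ (w.toFun t) (g t) := by
        rw [intervalIntegral.integral_of_le hab, ← integral_indicator measurableSet_Ioc]
        refine integral_congr_ae (Eventually.of_forall fun t => ?_)
        by_cases ht : t ∈ Ioc a b <;> simp [ht]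
      rw [← φ.intervalIntegral_comp_comm (hint w a b), e1,
        ← intervalIntegral.integral_add h0i hwi]
      refine intervalIntegral.integral_congr fun t _ => ?_
      simp only [pushVelocity, map_add, map_sum, map_smul, g, PiLp.inner_apply]
      simp [mul_comm]
    simp only [hkey]
    exact tendsto_const_nhds.add (Control.tendsto_nhds_iff.1 hv _ hgi)
  have heq : ∀ a b, a ≤ b → F (η b) - F (η a) =
      ∫ t in a..b, pushVelocity F f₀ f (u.toFun t) (η t) := by
    intro a b hab
    refine (SeparatingDual.eq_iff_forall_dual_eq (R := ℝ)).2 fun φ => ?_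
    refine tendsto_nhds_unique ((φ.continuous.tendsto _).comp ((hFη b).sub (hFη a))) ?_
    have h1 := ((φ.continuous.tendsto _).comp (hdiff a b)).add (hweak φ a b hab)
    rw [map_zero, zero_add] at h1
    refine h1.congr fun n => ?_
    simp [Function.comp]
  have hloc : LocallyIntegrable (fun t => pushVelocity F f₀ f (u.toFun t) (η t)) volume := by
    intro t
    refine ⟨Ioc (t - 1) (t + 1), Ioc_mem_nhds (by linarith) (by linarith), ?_⟩
    exact (intervalIntegrable_iff_integrableOn_Ioc_of_le (by linarith)).1 (hint u _ _)
  refine ⟨η, ⟨fun a b => hηlip.lipschitzOnWith.absolutelyContinuousOnInterval, ?_⟩, hηQ, hη⟩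
  filter_upwards [LocallyIntegrable.ae_hasDerivAt_integral hloc] with t ht
  have hderiv : HasDerivAt (F ∘ η) (pushVelocity F f₀ f (u.toFun t) (η t)) t := by
    -- The integral equation `heq` requires `a ≤ b`; the base point `t - 1` makes it available on
    -- both sides of `t`.
    have h1 := (ht (t - 1)).const_add (F (η (t - 1)))
    refine h1.congr_of_eventuallyEq ?_
    filter_upwards [Ioi_mem_nhds (show t - 1 < t by linarith)] with r hr
    rw [← heq (t - 1) r (le_of_lt hr)]
    simp
  obtain ⟨G, hG, hGF⟩ := hF.exists_leftInverse (η t) (hηQ t)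
  rw [pushVelocity_eq] at hderiv
  exact hasMFDerivAt_of_leftInverse (hF.contMDiff.mdifferentiable (by simp) (η t))
    (hG.mdifferentiableAt one_ne_zero) hGF hηc.continuousAt hderiv

end Flow

/-! ### Long stays in `Q` force proximity to the fibers -/

section Fiber

variable {d m : ℕ} {M : Type*} [MetricSpace M] [ChartedSpace (EuclideanSpace ℝ (Fin d)) M]
  [IsManifold (𝓡 d) ∞ M]
  [Bundle.RiemannianBundle (fun x : M => TangentSpace (𝓡 d) x)]
  [IsContMDiffRiemannianBundle (𝓡 d) ∞ (EuclideanSpace ℝ (Fin d))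
      (fun x : M => TangentSpace (𝓡 d) x)]
  [IsRiemannianManifold (𝓡 d) M]
  {f₀ : (x : M) → TangentSpace (𝓡 d) x} {f : Fin m → (x : M) → TangentSpace (𝓡 d) x}
  {U : Set (EuclideanSpace ℝ (Fin m))}

/-- Points whose trajectory stays in `Q` for a long time in both directions are close to the
fiber. -/
theorem exists_infEDist_fiber_le (hc : IsComplete f₀ f U)
    (hf₀ : ContMDiff (𝓡 d) (𝓡 d).tangent 2 (fun x => (⟨x, f₀ x⟩ : TangentBundle (𝓡 d) M)))
    (hf : ∀ i, ContMDiff (𝓡 d) (𝓡 d).tangent 2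
      (fun x => (⟨x, f i x⟩ : TangentBundle (𝓡 d) M)))
    (hU : IsCompact U) (hconv : Convex ℝ U) {Q : Set M} (hQ : IsCompact Q)
    (hP3 : LowerHemicontinuous (fun u : Control U => fiber f₀ f Q u)) {ε : ℝ} (hε : 0 < ε) :
    ∃ T : ℝ, 0 ≤ T ∧ ∀ (u : Control U) (x : M), (∀ t ∈ Icc (-T) T, flow f₀ f t x u ∈ Q) →
      Metric.infEDist x (fiber f₀ f Q u) ≤ ENNReal.ofReal ε := by
  by_contra! hcon
  -- Counterexamples for the horizons `T = n`.
  choose v x hvQ hvε using fun n : ℕ => hcon n n.cast_nonneg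
  have := Control.compactSpace hU hconv
  let l : Ultrafilter ℕ := hyperfilter ℕ
  obtain ⟨u, -, hu⟩ := isCompact_univ.ultrafilter_le_nhds (l.map v) (by simp)
  have hv : Tendsto v l (𝓝 u) := hu
  have hγ : ∀ n, IsTrajectory f₀ f (v n) (fun t => flow f₀ f t (x n) (v n)) := fun n =>
    (isTrajectory_flow hc (x n) (v n)).1
  have hle : (l : Filter ℕ) ≤ atTop := by
    rw [← Nat.cofinite_eq_atTop]
    exact hyperfilter_le_cofinite
  obtain ⟨η, hη, hηQ, hlim⟩ := exists_isTrajectory_of_tendsto l hQ hf₀ hf hU hv hγ (by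
    intro T
    refine hle ?_
    obtain ⟨N, hN⟩ := exists_nat_ge T
    filter_upwards [eventually_ge_atTop N] with n hn t ht
    have : T ≤ n := hN.trans (by exact_mod_cast hn)
    exact hvQ n t ⟨by linarith [ht.1], ht.2.trans this⟩)
  have hmem : η 0 ∈ fiber f₀ f Q u := fun t => hη.eq_flow hc hf₀ hf hU t ▸ hηQ t
  have h0 : Tendsto x l (𝓝 (η 0)) := (hlim 0).congr fun n => (isTrajectory_flow hc _ _).2
  -- Lower semicontinuity at `u` produces points of the fibers of the nearby `v n` within `ε / 2` of
  -- `η 0`, to which the `x n` also converge.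
  have h1 := hv.eventually (lowerHemicontinuousAt_iff.1 (hP3 u) (Metric.ball (η 0) (ε / 2))
    Metric.isOpen_ball ⟨η 0, hmem, Metric.mem_ball_self (by positivity)⟩)
  have h2 := h0.eventually (Metric.ball_mem_nhds (η 0) (show 0 < ε / 2 by positivity))
  obtain ⟨n, ⟨y, hyf, hyb⟩, hxb⟩ := (h1.and h2).exists
  refine absurd (hvε n) (not_lt.2 ((Metric.infEDist_le_edist_of_mem hyf).trans ?_))
  rw [edist_dist]
  refine ENNReal.ofReal_le_ofReal ((dist_triangle_right _ _ (η 0)).trans ?_)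
  linarith [Metric.mem_ball.1 hyb, Metric.mem_ball.1 hxb]

/-- After a delay `T`, every instant of `[0, t]` is preceded and followed by time `T` spent in `Q`;
hence the total time `t + 2 * T`. -/
theorem exists_flow_mem_fiberTube (hc : IsComplete f₀ f U)
    (hf₀ : ContMDiff (𝓡 d) (𝓡 d).tangent 2 (fun x => (⟨x, f₀ x⟩ : TangentBundle (𝓡 d) M)))
    (hf : ∀ i, ContMDiff (𝓡 d) (𝓡 d).tangent 2
      (fun x => (⟨x, f i x⟩ : TangentBundle (𝓡 d) M)))
    (hU : IsCompact U) (hconv : Convex ℝ U) {Q : Set M} (hQ : IsCompact Q)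
    (hP3 : LowerHemicontinuous (fun u : Control U => fiber f₀ f Q u)) {ε : ℝ} (hε : 0 < ε) :
    ∃ T : ℝ, 0 ≤ T ∧ ∀ (u : Control U) (x : M) (t : ℝ),
      (∀ s ∈ Icc 0 (t + 2 * T), flow f₀ f s x u ∈ Q) →
      flow f₀ f T x u ∈ fiberTube f₀ f Q t (u.shift T) ε := by
  obtain ⟨T, hT, h⟩ := exists_infEDist_fiber_le hc hf₀ hf hU hconv hQ hP3 hε
  refine ⟨T, hT, fun u x t hx s hs => ?_⟩
  rw [flow_flow hc hf₀ hf hU, Control.shift_shift]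
  refine h _ _ fun r hr => ?_
  rw [flow_flow hc hf₀ hf hU]
  exact hx _ ⟨by linarith [hr.1, hs.1], by linarith [hr.2, hs.2]⟩

end Fiber

/-! ### Gram determinants under change of charts -/

section ChartVolume

variable {d : ℕ} {M : Type*} [MetricSpace M] [ChartedSpace (EuclideanSpace ℝ (Fin d)) M]
  [Bundle.RiemannianBundle (fun x : M => TangentSpace (𝓡 d) x)]

/-- The Riemannian inner product at `x` of two vectors of the model space. -/
def metricForm (x : M) (v w : EuclideanSpace ℝ (Fin d)) : ℝ :=
  inner ℝ (show TangentSpace (𝓡 d) x from v) (show TangentSpace (𝓡 d) x from w)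

theorem metricForm_sum (x : M) {ι : Type*} (s : Finset ι) (a b : ι → ℝ)
    (v w : ι → EuclideanSpace ℝ (Fin d)) :
    metricForm x (∑ k ∈ s, a k • v k) (∑ l ∈ s, b l • w l) =
      ∑ k ∈ s, ∑ l ∈ s, a k * b l * metricForm x (v k) (w l) := by
  have h1 : metricForm x (∑ k ∈ s, a k • v k) (∑ l ∈ s, b l • w l) =
      inner ℝ (∑ k ∈ s, a k • (show TangentSpace (𝓡 d) x from v k))
        (∑ l ∈ s, b l • (show TangentSpace (𝓡 d) x from w l)) := rfl
  rw [h1, sum_inner]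
  refine Finset.sum_congr rfl fun k _ => ?_
  rw [inner_sum]
  refine Finset.sum_congr rfl fun l _ => ?_
  rw [real_inner_smul_left, real_inner_smul_right, mul_assoc]
  rfl

/-- The Gram determinant of the images of the standard basis under a linear map. -/
def gramDet (x : M) (L : EuclideanSpace ℝ (Fin d) →L[ℝ] EuclideanSpace ℝ (Fin d)) : ℝ :=
  (Matrix.of fun i j : Fin d => metricForm x (L (EuclideanSpace.single i (1 : ℝ)))
    (L (EuclideanSpace.single j (1 : ℝ)))).det

/-- Precomposition with a linear map of matrix `A` turns the Gram matrix `G` into `Aᵀ G A`. -/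
theorem gramDet_comp (x : M) (L P : EuclideanSpace ℝ (Fin d) →L[ℝ] EuclideanSpace ℝ (Fin d)) :
    gramDet x (L.comp P) = P.det ^ 2 * gramDet x L := by
  let b := (EuclideanSpace.basisFun (Fin d) ℝ).toBasis
  let A := LinearMap.toMatrix b b (P : EuclideanSpace ℝ (Fin d) →ₗ[ℝ] EuclideanSpace ℝ (Fin d))
  have hb : ∀ i, b i = EuclideanSpace.single i (1 : ℝ) := fun i => by simp [b]
  have hP : ∀ i, P (EuclideanSpace.single i (1 : ℝ)) =
      ∑ k, A k i • EuclideanSpace.single k (1 : ℝ) := by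
    intro i
    have := b.sum_repr (P (b i))
    rw [← hb i, ← this]
    refine Finset.sum_congr rfl fun k _ => ?_
    have hA : A k i = b.repr (P (b i)) k := LinearMap.toMatrix_apply _ _ _ _ _
    rw [hA, ← hb k]
  have hmat : (Matrix.of fun i j : Fin d =>
      metricForm x (L.comp P (EuclideanSpace.single i (1 : ℝ)))
        (L.comp P (EuclideanSpace.single j (1 : ℝ)))) =
      A.transpose * (Matrix.of fun i j : Fin d =>
        metricForm x (L (EuclideanSpace.single i (1 : ℝ)))
          (L (EuclideanSpace.single j (1 : ℝ)))) * A := by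
    ext i j
    rw [Matrix.of_apply, ContinuousLinearMap.comp_apply, ContinuousLinearMap.comp_apply, hP, hP,
      map_sum, map_sum]
    simp only [map_smul]
    rw [metricForm_sum, Finset.sum_comm, Matrix.mul_apply]
    refine Finset.sum_congr rfl fun l _ => ?_
    rw [Matrix.mul_apply, Finset.sum_mul]
    refine Finset.sum_congr rfl fun k _ => ?_
    rw [Matrix.transpose_apply, Matrix.of_apply]
    ring
  have hdet : A.det = P.det := LinearMap.det_toMatrix b _
  rw [gramDet, hmat, Matrix.det_mul, Matrix.det_mul, Matrix.det_transpose, hdet, gramDet]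
  ring

theorem det_chartGram (p : M) (y : EuclideanSpace ℝ (Fin d)) :
    (chartGram d p y).det = gramDet ((chartAt (EuclideanSpace ℝ (Fin d)) p).symm y)
      (mfderiv (𝓡 d) (𝓡 d) (chartAt (EuclideanSpace ℝ (Fin d)) p).symm y) := rfl

/-- The coordinate change between two charts. -/
def transition (p q : M) : EuclideanSpace ℝ (Fin d) → EuclideanSpace ℝ (Fin d) :=
  chartAt (EuclideanSpace ℝ (Fin d)) q ∘ (chartAt (EuclideanSpace ℝ (Fin d)) p).symm

variable [IsManifold (𝓡 d) ∞ M]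

omit [Bundle.RiemannianBundle (fun x : M => TangentSpace (𝓡 d) x)] in
theorem differentiableAt_transition (p q : M) {y : EuclideanSpace ℝ (Fin d)}
    (hy : y ∈ (chartAt (EuclideanSpace ℝ (Fin d)) p).target)
    (hyq : (chartAt (EuclideanSpace ℝ (Fin d)) p).symm y ∈
      (chartAt (EuclideanSpace ℝ (Fin d)) q).source) :
    DifferentiableAt ℝ (transition p q) y := by
  rw [← mdifferentiableAt_iff_differentiableAt]
  exact ((mdifferentiable_chart (I := 𝓡 d) q).mdifferentiableAt hyq).comp y
    ((mdifferentiable_chart (I := 𝓡 d) p).mdifferentiableAt_symm hy)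

/-- Near `y` the inverse chart at `p` is the inverse chart at `q` after the transition map, so the
chain rule reduces the claim to `gramDet_comp`. -/
theorem det_chartGram_transition (p q : M) {y : EuclideanSpace ℝ (Fin d)}
    (hy : y ∈ (chartAt (EuclideanSpace ℝ (Fin d)) p).target)
    (hyq : (chartAt (EuclideanSpace ℝ (Fin d)) p).symm y ∈
      (chartAt (EuclideanSpace ℝ (Fin d)) q).source) :
    (chartGram d p y).det =
      (fderiv ℝ (transition p q) y).det ^ 2 * (chartGram d q (transition p q y)).det := by
  set φ := chartAt (EuclideanSpace ℝ (Fin d)) p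
  set ψ := chartAt (EuclideanSpace ℝ (Fin d)) q
  have hτ : HasMFDerivAt (𝓡 d) (𝓡 d) (transition p q) y (fderiv ℝ (transition p q) y) :=
    (differentiableAt_transition p q hy hyq).hasFDerivAt.hasMFDerivAt
  have hψ : HasMFDerivAt (𝓡 d) (𝓡 d) ψ.symm (transition p q y)
      (mfderiv (𝓡 d) (𝓡 d) ψ.symm (transition p q y)) :=
    ((mdifferentiable_chart (I := 𝓡 d) q).mdifferentiableAt_symm (ψ.map_source hyq)).hasMFDerivAt
  have hev : ∀ᶠ z in 𝓝 y, φ.symm z ∈ ψ.source :=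
    (φ.continuousAt_symm hy).eventually (ψ.open_source.mem_nhds hyq)
  have hcomp : HasMFDerivAt (𝓡 d) (𝓡 d) φ.symm y
      ((mfderiv (𝓡 d) (𝓡 d) ψ.symm (transition p q y)).comp (fderiv ℝ (transition p q) y)) := by
    refine (hψ.comp y hτ).congr_of_eventuallyEq ?_
    filter_upwards [hev] with z hz
    exact (ψ.left_inv hz).symm
  have hx : ψ.symm (transition p q y) = φ.symm y := ψ.left_inv hyq
  have h1 : (chartGram d p y).det = gramDet (φ.symm y)
      (ContinuousLinearMap.comp (show EuclideanSpace ℝ (Fin d) →L[ℝ] EuclideanSpace ℝ (Fin d) from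
        mfderiv (𝓡 d) (𝓡 d) ψ.symm (transition p q y)) (fderiv ℝ (transition p q) y)) := by
    rw [det_chartGram]
    exact congrArg (gramDet (φ.symm y)) hcomp.mfderiv
  rw [h1, gramDet_comp, det_chartGram, hx]

end ChartVolume

/-! ### The glued volume restricts to the chart volumes -/

section Gluing

variable {d : ℕ} {M : Type*} [MetricSpace M] [MeasurableSpace M] [BorelSpace M]
  [ChartedSpace (EuclideanSpace ℝ (Fin d)) M]
  [Bundle.RiemannianBundle (fun x : M => TangentSpace (𝓡 d) x)]

omit [Bundle.RiemannianBundle (fun x : M => TangentSpace (𝓡 d) x)] in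
theorem measurableSet_chart_symm_preimage (p : M) {A : Set M} (hA : MeasurableSet A) :
    MeasurableSet ((chartAt (EuclideanSpace ℝ (Fin d)) p).symm ⁻¹' A ∩
      (chartAt (EuclideanSpace ℝ (Fin d)) p).target) := by
  set φ := chartAt (EuclideanSpace ℝ (Fin d)) p
  have h : Measurable (φ.target.domRestrict φ.symm) :=
    (continuousOn_iff_continuous_domRestrict.1 φ.continuousOn_symm).measurable
  have := φ.open_target.measurableSet.subtype_image (h hA)
  convert this using 1
  ext y
  simp [and_comm]

theorem chartVolume_apply (p : M) {A : Set M} (hA : MeasurableSet A) :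
    chartVolume d p A = ∫⁻ y in (chartAt (EuclideanSpace ℝ (Fin d)) p).symm ⁻¹' A ∩
      (chartAt (EuclideanSpace ℝ (Fin d)) p).target,
        ENNReal.ofReal (Real.sqrt (chartGram d p y).det) := by
  set φ := chartAt (EuclideanSpace ℝ (Fin d)) p
  have hm : AEMeasurable φ.symm ((volume.restrict φ.target).withDensity
      fun y => ENNReal.ofReal (Real.sqrt (chartGram d p y).det)) :=
    (φ.continuousOn_symm.aemeasurable φ.open_target.measurableSet).mono_ac
      (withDensity_absolutelyContinuous _ _)
  rw [chartVolume, Measure.map_apply_of_aemeasurable hm hA, withDensity_apply',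
    Measure.restrict_restrict' φ.open_target.measurableSet]

theorem chartVolume_inter_source (p : M) {A : Set M} (hA : MeasurableSet A) :
    chartVolume d p (A ∩ (chartAt (EuclideanSpace ℝ (Fin d)) p).source) = chartVolume d p A := by
  set φ := chartAt (EuclideanSpace ℝ (Fin d)) p
  rw [chartVolume_apply p hA, chartVolume_apply p (hA.inter φ.open_source.measurableSet)]
  congr 2
  ext y
  simp only [preimage_inter, mem_inter_iff, mem_preimage]
  exact ⟨fun h => ⟨h.1.1, h.2⟩, fun h => ⟨⟨h.1, φ.map_target h.2⟩, h.2⟩⟩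

variable [IsManifold (𝓡 d) ∞ M]

/-- Change of variables along the transition map: its Jacobian is exactly the quotient of the two
densities. -/
theorem chartVolume_eq_chartVolume (p q : M) {A : Set M} (hA : MeasurableSet A)
    (hp : A ⊆ (chartAt (EuclideanSpace ℝ (Fin d)) p).source)
    (hq : A ⊆ (chartAt (EuclideanSpace ℝ (Fin d)) q).source) :
    chartVolume d p A = chartVolume d q A := by
  rw [chartVolume_apply p hA, chartVolume_apply q hA]
  set φ := chartAt (EuclideanSpace ℝ (Fin d)) p
  set ψ := chartAt (EuclideanSpace ℝ (Fin d)) q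
  set S := φ.symm ⁻¹' A ∩ φ.target
  have himage : ψ.symm ⁻¹' A ∩ ψ.target = transition p q '' S := by
    ext z
    constructor
    · rintro ⟨hz, hzt⟩
      refine ⟨φ (ψ.symm z), ⟨?_, φ.map_source (hp hz)⟩, ?_⟩
      · show φ.symm (φ (ψ.symm z)) ∈ A
        rw [φ.left_inv (hp hz)]
        exact hz
      · show ψ (φ.symm (φ (ψ.symm z))) = z
        rw [φ.left_inv (hp hz), ψ.right_inv hzt]
    · rintro ⟨y, ⟨hy, hyt⟩, rfl⟩
      refine ⟨?_, ψ.map_source (hq hy)⟩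
      show ψ.symm (ψ (φ.symm y)) ∈ A
      rw [ψ.left_inv (hq hy)]
      exact hy
  have hinj : InjOn (transition p q) S := by
    rintro y ⟨hy, hyt⟩ z ⟨hz, hzt⟩ hyz
    exact φ.symm.injOn hyt hzt (ψ.injOn (hq hy) (hq hz) hyz)
  rw [himage, lintegral_image_eq_lintegral_abs_det_fderiv_mul volume
    (measurableSet_chart_symm_preimage p hA)
    (fun y hy => (differentiableAt_transition p q hy.2 (hq hy.1)).hasFDerivAt.hasFDerivWithinAt)
    hinj]
  refine setLIntegral_congr_fun (measurableSet_chart_symm_preimage p hA) fun y hy => ?_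
  show ENNReal.ofReal (Real.sqrt (chartGram d p y).det) = _
  rw [det_chartGram_transition p q hy.2 (hq hy.1), Real.sqrt_mul (sq_nonneg _), Real.sqrt_sq_eq_abs,
    ENNReal.ofReal_mul (abs_nonneg _)]

/-- On the domain of a chart the Riemannian volume is the volume of the chart. -/
theorem riemannianVolume_eq_chartVolume (q : M) {A : Set M} (hA : MeasurableSet A)
    (hq : A ⊆ (chartAt (EuclideanSpace ℝ (Fin d)) q).source) :
    riemannianVolume d M A = chartVolume d q A := by
  have hle : ∀ p, chartVolume d p ≤ riemannianVolume d M := fun p =>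
    le_iSup (fun p : M => chartVolume d p) p
  refine le_antisymm ?_ (hle q A)
  set S := (chartAt (EuclideanSpace ℝ (Fin d)) q).source
  have hS : MeasurableSet S := (chartAt (EuclideanSpace ℝ (Fin d)) q).open_source.measurableSet
  -- The volume is the least measure above all chart volumes, so it suffices that the right side
  -- dominates each: on `S` because chart volumes agree on overlaps, off `S` by `hle`.
  have hν : riemannianVolume d M ≤ chartVolume d q + (riemannianVolume d M).restrict Sᶜ := by
    refine iSup_le fun p => Measure.le_iff.2 fun B hB => ?_
    set R := (chartAt (EuclideanSpace ℝ (Fin d)) p).source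
    have hR : MeasurableSet R := (chartAt (EuclideanSpace ℝ (Fin d)) p).open_source.measurableSet
    rw [← measure_inter_add_sdiff B hS, Measure.add_apply, Measure.restrict_apply hB]
    refine add_le_add ?_ (hle p _)
    rw [← chartVolume_inter_source p (hB.inter hS),
      chartVolume_eq_chartVolume p q ((hB.inter hS).inter hR) inter_subset_right
        (inter_subset_left.trans inter_subset_right)]
    exact measure_mono (inter_subset_left.trans inter_subset_left)
  refine (hν A).trans ?_
  rw [Measure.add_apply, Measure.restrict_apply hA,
    show A ∩ Sᶜ = ∅ from disjoint_iff_inter_eq_empty.1 (disjoint_compl_right_iff_subset.2 hq),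
    measure_empty, add_zero]

end Gluing

/-! ### Continuity and positivity of the density -/

section Density

variable {d : ℕ} {M : Type*} [MetricSpace M]
  [ChartedSpace (EuclideanSpace ℝ (Fin d)) M] [IsManifold (𝓡 d) ∞ M]
  [Bundle.RiemannianBundle (fun x : M => TangentSpace (𝓡 d) x)]

/-- The coordinate fields are images of constant fields under the tangent map of the inverse chart,
hence continuous, and so are their inner products. -/
theorem continuousOn_chartGram [IsContMDiffRiemannianBundle (𝓡 d) ∞ (EuclideanSpace ℝ (Fin d))
      (fun x : M => TangentSpace (𝓡 d) x)] (p : M) :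
    ContinuousOn (chartGram d p) (chartAt (EuclideanSpace ℝ (Fin d)) p).target := by
  have : IsContinuousRiemannianBundle (EuclideanSpace ℝ (Fin d))
    (fun x : M => TangentSpace (𝓡 d) x) := isContinuousRiemannianBundle d M
  set ψ := chartAt (EuclideanSpace ℝ (Fin d)) p
  have hψ : ContMDiffOn (𝓡 d) (𝓡 d) 1 ψ.symm ψ.target := contMDiffOn_chart_symm
  have hT := hψ.continuousOn_tangentMapWithin le_rfl ψ.open_target.uniqueMDiffOn
  have hv : ∀ i : Fin d, ContinuousOn (fun y : EuclideanSpace ℝ (Fin d) =>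
      (⟨ψ.symm y, mfderiv (𝓡 d) (𝓡 d) ψ.symm y
        (show TangentSpace (𝓡 d) y from EuclideanSpace.single i (1 : ℝ))⟩ :
          TangentBundle (𝓡 d) M)) ψ.target := by
    intro i
    have hc : Continuous (fun y : EuclideanSpace ℝ (Fin d) =>
        (⟨y, EuclideanSpace.single i (1 : ℝ)⟩ :
          TangentBundle (𝓡 d) (EuclideanSpace ℝ (Fin d)))) :=
      (tangentBundleModelSpaceHomeomorph (𝓡 d)).symm.continuous.comp
        (continuous_id.prodMk continuous_const)
    refine (hT.comp hc.continuousOn fun y hy => hy).congr fun y hy => ?_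
    have h1 : mfderivWithin (𝓡 d) (𝓡 d) ψ.symm ψ.target y = mfderiv (𝓡 d) (𝓡 d) ψ.symm y :=
      mfderivWithin_of_isOpen ψ.open_target hy
    simp only [Function.comp, tangentMapWithin, h1]
  refine continuousOn_pi.2 fun i => continuousOn_pi.2 fun j => ?_
  exact (hv i).inner_bundle (hv j)

/-- The differential of the inverse chart is injective, and the Gram matrix of independent vectors
is positive definite. -/
theorem det_chartGram_pos (p : M) {y : EuclideanSpace ℝ (Fin d)}
    (hy : y ∈ (chartAt (EuclideanSpace ℝ (Fin d)) p).target) : 0 < (chartGram d p y).det := by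
  set ψ := chartAt (EuclideanSpace ℝ (Fin d)) p
  have hli : LinearIndependent ℝ (fun i : Fin d =>
      mfderiv (𝓡 d) (𝓡 d) ψ.symm y
        (show TangentSpace (𝓡 d) y from EuclideanSpace.single i (1 : ℝ))) := by
    have hb : LinearIndependent ℝ (fun i : Fin d => (EuclideanSpace.single i (1 : ℝ))) := by
      have := (EuclideanSpace.basisFun (Fin d) ℝ).toBasis.linearIndependent
      have he : (fun i : Fin d => EuclideanSpace.single i (1 : ℝ)) =
          ⇑(EuclideanSpace.basisFun (Fin d) ℝ).toBasis := by
        ext1 i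
        simp
      rw [he]
      exact this
    have hker := (mdifferentiable_chart (I := 𝓡 d) p).symm.ker_mfderiv_eq_bot (x := y) hy
    exact LinearIndependent.map' hb
      (mfderiv (𝓡 d) (𝓡 d) ψ.symm y).toLinearMap hker
  exact (Matrix.posDef_gram_of_linearIndependent hli).det_pos

theorem exists_density_bounds [IsContMDiffRiemannianBundle (𝓡 d) ∞ (EuclideanSpace ℝ (Fin d))
      (fun x : M => TangentSpace (𝓡 d) x)] (q : M) :
    ∃ V : Set M, IsOpen V ∧ q ∈ V ∧ V ⊆ (chartAt (EuclideanSpace ℝ (Fin d)) q).source ∧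
      ∃ c C : ℝ≥0∞, c ≠ 0 ∧ c ≠ ⊤ ∧ C ≠ ⊤ ∧ ∀ x ∈ V,
        c ≤ ENNReal.ofReal (Real.sqrt (chartGram d q
          (chartAt (EuclideanSpace ℝ (Fin d)) q x)).det) ∧
        ENNReal.ofReal (Real.sqrt (chartGram d q
          (chartAt (EuclideanSpace ℝ (Fin d)) q x)).det) ≤ C := by
  set ψ := chartAt (EuclideanSpace ℝ (Fin d)) q
  have hq : q ∈ ψ.source := mem_chart_source _ q
  set ρ : M → ℝ := fun x => Real.sqrt (chartGram d q (ψ x)).det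
  have hρ : ContinuousAt ρ q := by
    have h1 : ContinuousAt (chartGram d q) (ψ q) :=
      (continuousOn_chartGram q).continuousAt (ψ.open_target.mem_nhds (ψ.map_source hq))
    have h2 : ContinuousAt (fun x => chartGram d q (ψ x)) q :=
      ContinuousAt.comp (f := ψ) h1 (ψ.continuousAt hq)
    have h3 : Continuous fun A : Matrix (Fin d) (Fin d) ℝ => Real.sqrt A.det :=
      Real.continuous_sqrt.comp continuous_id.matrix_det
    exact h3.continuousAt.comp h2
  have hpos : 0 < ρ q := Real.sqrt_pos.2 (det_chartGram_pos q (ψ.map_source hq))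
  have hev : ∀ᶠ x in 𝓝 q, x ∈ ψ.source ∧ ρ q / 2 < ρ x ∧ ρ x < ρ q + 1 :=
    Filter.Eventually.and (ψ.open_source.mem_nhds hq)
      ((hρ.eventually_const_lt (by linarith)).and (hρ.eventually_lt_const (by linarith)))
  obtain ⟨V, hV, hVo, hqV⟩ := eventually_nhds_iff.1 hev
  refine ⟨V, hVo, hqV, fun x hx => (hV x hx).1, ENNReal.ofReal (ρ q / 2),
    ENNReal.ofReal (ρ q + 1), ?_, ENNReal.ofReal_ne_top, ENNReal.ofReal_ne_top, fun x hx =>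
    ⟨ENNReal.ofReal_le_ofReal (hV x hx).2.1.le, ENNReal.ofReal_le_ofReal (hV x hx).2.2.le⟩⟩
  simpa using hpos

end Density

/-! ### Riemannian volume versus Hausdorff measure of the image -/

section Comparison

open scoped NNReal

variable {d : ℕ} {M : Type*} [MetricSpace M] [MeasurableSpace M] [BorelSpace M]
  [ChartedSpace (EuclideanSpace ℝ (Fin d)) M] [IsManifold (𝓡 d) ∞ M]
  [Bundle.RiemannianBundle (fun x : M => TangentSpace (𝓡 d) x)]
  [IsContMDiffRiemannianBundle (𝓡 d) ∞ (EuclideanSpace ℝ (Fin d))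
      (fun x : M => TangentSpace (𝓡 d) x)]

theorem exists_riemannianVolume_le_volume (q : M) :
    ∃ V ∈ 𝓝 q, ∃ C : ℝ≥0∞, C ≠ ⊤ ∧ ∀ A ⊆ V,
      riemannianVolume d M A ≤ C * volume (chartAt (EuclideanSpace ℝ (Fin d)) q '' A) ∧
      volume (chartAt (EuclideanSpace ℝ (Fin d)) q '' A) ≤ C * riemannianVolume d M A := by
  obtain ⟨V, hVo, hqV, hVs, c, C, hc0, hct, hC, hb⟩ := exists_density_bounds (d := d) q
  set ψ := chartAt (EuclideanSpace ℝ (Fin d)) q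
  refine ⟨V, hVo.mem_nhds hqV, max C c⁻¹, by simp [hC, hc0], fun A hA => ⟨?_, ?_⟩⟩
  -- `A` need not be measurable, so both inequalities pass through measurable hulls, intersected
  -- with `V` to keep the density bounds.
  · set N := toMeasurable volume (ψ '' A)
    have hB : MeasurableSet (ψ.symm ⁻¹' V ∩ ψ.target ∩ N) :=
      (measurableSet_chart_symm_preimage q hVo.measurableSet).inter (measurableSet_toMeasurable _ _)
    set B := V ∩ ψ ⁻¹' N
    have hBm : MeasurableSet B := by
      have h : Measurable (V.domRestrict ψ) :=
        (continuousOn_iff_continuous_domRestrict.1 (ψ.continuousOn.mono hVs)).measurable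
      have := hVo.measurableSet.subtype_image (h (measurableSet_toMeasurable volume (ψ '' A)))
      convert this using 1
      ext y
      simp [B, N, and_comm]
    have hAB : A ⊆ B := fun x hx => ⟨hA hx, subset_toMeasurable _ _ ⟨x, hx, rfl⟩⟩
    calc riemannianVolume d M A ≤ riemannianVolume d M B := measure_mono hAB
      _ = ∫⁻ y in ψ.symm ⁻¹' B ∩ ψ.target,
          ENNReal.ofReal (Real.sqrt (chartGram d q y).det) := by
        rw [riemannianVolume_eq_chartVolume q hBm (inter_subset_left.trans hVs),
          chartVolume_apply q hBm]
      _ ≤ ∫⁻ _ in ψ.symm ⁻¹' B ∩ ψ.target, C := by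
        refine setLIntegral_mono' (measurableSet_chart_symm_preimage q hBm) fun y hy => ?_
        have := (hb _ hy.1.1).2
        rwa [ψ.right_inv hy.2] at this
      _ = C * volume (ψ.symm ⁻¹' B ∩ ψ.target) := setLIntegral_const _ _
      _ ≤ C * volume N := by
        refine mul_le_mul_right (measure_mono fun y hy => ?_) _
        have : ψ (ψ.symm y) ∈ N := hy.1.2
        rwa [ψ.right_inv hy.2] at this
      _ = C * volume (ψ '' A) := by rw [measure_toMeasurable]
      _ ≤ max C c⁻¹ * volume (ψ '' A) := mul_le_mul_left (le_max_left _ _) _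
  · set B := toMeasurable (riemannianVolume d M) A ∩ V
    have hBm : MeasurableSet B := (measurableSet_toMeasurable _ _).inter hVo.measurableSet
    have h1 : c * volume (ψ '' A) ≤ riemannianVolume d M A := by
      calc c * volume (ψ '' A) ≤ c * volume (ψ.symm ⁻¹' B ∩ ψ.target) := by
            refine mul_le_mul_right (measure_mono ?_) _
            rintro _ ⟨x, hx, rfl⟩
            refine ⟨?_, ψ.map_source (hVs (hA hx))⟩
            show ψ.symm (ψ x) ∈ B
            rw [ψ.left_inv (hVs (hA hx))]
            exact ⟨subset_toMeasurable _ _ hx, hA hx⟩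
        _ = ∫⁻ _ in ψ.symm ⁻¹' B ∩ ψ.target, c := (setLIntegral_const _ _).symm
        _ ≤ ∫⁻ y in ψ.symm ⁻¹' B ∩ ψ.target,
            ENNReal.ofReal (Real.sqrt (chartGram d q y).det) := by
          refine setLIntegral_mono' (measurableSet_chart_symm_preimage q hBm) fun y hy => ?_
          have := (hb _ hy.1.2).1
          rwa [ψ.right_inv hy.2] at this
        _ = riemannianVolume d M B := by
          rw [riemannianVolume_eq_chartVolume q hBm (inter_subset_right.trans hVs),
            chartVolume_apply q hBm]
        _ ≤ riemannianVolume d M A := by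
          rw [← measure_toMeasurable (μ := riemannianVolume d M) A]
          exact measure_mono inter_subset_left
    calc volume (ψ '' A) = c⁻¹ * (c * volume (ψ '' A)) := by
          rw [← mul_assoc, ENNReal.inv_mul_cancel hc0 hct, one_mul]
      _ ≤ c⁻¹ * riemannianVolume d M A := mul_le_mul_right h1 _
      _ ≤ max C c⁻¹ * riemannianVolume d M A := mul_le_mul_left (le_max_right _ _) _

variable {E : Type*} [NormedAddCommGroup E] [NormedSpace ℝ E] [MeasurableSpace E] [BorelSpace E]

omit [MeasurableSpace M] [BorelSpace M]
  [Bundle.RiemannianBundle (fun x : M => TangentSpace (𝓡 d) x)]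
  [IsContMDiffRiemannianBundle (𝓡 d) ∞ (EuclideanSpace ℝ (Fin d))
      (fun x : M => TangentSpace (𝓡 d) x)] in
open scoped MeasureTheory.Measure in
-- Near `q` the maps `F ∘ ψ.symm` and `ψ ∘ G` are Lipschitz and carry the two images of `A` onto
-- each other.
theorem IsEmbeddingNear.exists_volume_image_le {Q : Set M} {F : M → E}
    (hF : IsEmbeddingNear d Q F) {q : M} (hq : q ∈ Q) :
    ∃ V ∈ 𝓝 q, ∃ C : ℝ≥0∞, C ≠ ⊤ ∧ ∀ A ⊆ V,
      μH[(d : ℝ)] (F '' A) ≤ C * μH[(d : ℝ)] (chartAt (EuclideanSpace ℝ (Fin d)) q '' A) ∧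
      μH[(d : ℝ)] (chartAt (EuclideanSpace ℝ (Fin d)) q '' A) ≤ C * μH[(d : ℝ)] (F '' A) := by
  set ψ := extChartAt (𝓡 d) q
  have hψ : ContMDiffAt (𝓡 d) 𝓘(ℝ, EuclideanSpace ℝ (Fin d)) 1 ψ q := contMDiffAt_extChartAt
  have h1 : ContDiffAt ℝ 1 (F ∘ ψ.symm) (ψ q) := by
    rw [← contMDiffAt_iff_contDiffAt]
    have hs : ContMDiffAt 𝓘(ℝ, EuclideanSpace ℝ (Fin d)) (𝓡 d) 1 ψ.symm (ψ q) :=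
      (contMDiffOn_extChartAt_symm (I := 𝓡 d) (n := 1) q).contMDiffAt
        (extChartAt_target_mem_nhds q)
    exact (hF.contMDiff.of_le (by simp)).contMDiffAt.comp _ hs
  obtain ⟨G, hG, hGF⟩ := hF.exists_leftInverse q hq
  have h2 : ContDiffAt ℝ 1 (ψ ∘ G) (F q) := by
    rw [← contMDiffAt_iff_contDiffAt]
    rw [← hGF.self_of_nhds] at hψ
    exact hψ.comp _ hG
  obtain ⟨K₁, s₁, hs₁, hK₁⟩ := h1.exists_lipschitzOnWith
  obtain ⟨K₂, s₂, hs₂, hK₂⟩ := h2.exists_lipschitzOnWith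
  have hd : (0 : ℝ) ≤ d := d.cast_nonneg
  have hev : ∀ᶠ x in 𝓝 q, x ∈ ψ.source ∧ ψ x ∈ s₁ ∧ F x ∈ s₂ ∧ G (F x) = x :=
    Filter.Eventually.and (extChartAt_source_mem_nhds (I := 𝓡 d) q)
      (Filter.Eventually.and (continuousAt_extChartAt (I := 𝓡 d) q hs₁)
        (Filter.Eventually.and (hF.contMDiff.continuous.continuousAt hs₂) hGF))
  refine ⟨_, hev, max ((K₁ : ℝ≥0∞) ^ (d : ℝ)) ((K₂ : ℝ≥0∞) ^ (d : ℝ)), ?_, fun A hA => ⟨?_, ?_⟩⟩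
  · simp
  · have himg : F '' A = (F ∘ ψ.symm) '' (ψ '' A) := by
      rw [image_image]
      refine image_congr fun x hx => ?_
      rw [Function.comp, ψ.left_inv (hA hx).1]
    rw [himg]
    refine ((hK₁.mono ?_).hausdorffMeasure_image_le hd).trans
      (mul_le_mul_left (le_max_left _ _) _)
    rintro _ ⟨x, hx, rfl⟩
    exact (hA hx).2.1
  · have himg : ψ '' A = (ψ ∘ G) '' (F '' A) := by
      rw [image_image]
      refine image_congr fun x hx => ?_
      rw [Function.comp, (hA hx).2.2.2]
    show μH[(d : ℝ)] (ψ '' A) ≤ _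
    rw [himg]
    refine ((hK₂.mono ?_).hausdorffMeasure_image_le hd).trans
      (mul_le_mul_left (le_max_right _ _) _)
    rintro _ ⟨x, hx, rfl⟩
    exact (hA hx).2.2.1

open scoped MeasureTheory.Measure in
/-- On a compact set, the Riemannian volume is comparable to the Hausdorff measure of the image
under an embedding. -/
theorem IsEmbeddingNear.exists_riemannianVolume_le {Q : Set M} (hQ : IsCompact Q) {F : M → E}
    (hF : IsEmbeddingNear d Q F) :
    ∃ C : ℝ≥0∞, C ≠ ⊤ ∧ ∀ A ⊆ Q, riemannianVolume d M A ≤ C * μH[(d : ℝ)] (F '' A) ∧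
      μH[(d : ℝ)] (F '' A) ≤ C * riemannianVolume d M A := by
  refine hQ.induction_on (p := fun S => ∃ C : ℝ≥0∞, C ≠ ⊤ ∧ ∀ A ⊆ S,
    riemannianVolume d M A ≤ C * μH[(d : ℝ)] (F '' A) ∧
      μH[(d : ℝ)] (F '' A) ≤ C * riemannianVolume d M A) ⟨0, by simp, ?_⟩ ?_ ?_ ?_
  · intro A hA
    rw [subset_empty_iff.1 hA]
    simp
  · rintro S T hST ⟨C, hC, h⟩
    exact ⟨C, hC, fun A hA => h A (hA.trans hST)⟩
  · rintro S T ⟨C, hC, h⟩ ⟨C', hC', h'⟩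
    refine ⟨C + C', ENNReal.add_ne_top.2 ⟨hC, hC'⟩, fun A hA => ?_⟩
    have hu : A = (A ∩ S) ∪ (A ∩ T) := by
      rw [← inter_union_distrib_left, inter_eq_left.2 hA]
    have hS := h _ (inter_subset_right : A ∩ S ⊆ S)
    have hT := h' _ (inter_subset_right : A ∩ T ⊆ T)
    rw [add_mul, add_mul]
    constructor
    · calc riemannianVolume d M A ≤ riemannianVolume d M (A ∩ S) +
          riemannianVolume d M (A ∩ T) := by
            conv_lhs => rw [hu]
            exact measure_union_le _ _
        _ ≤ _ := add_le_add
            (hS.1.trans (mul_le_mul_right (measure_mono (image_mono inter_subset_left)) _))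
            (hT.1.trans (mul_le_mul_right (measure_mono (image_mono inter_subset_left)) _))
    · calc μH[(d : ℝ)] (F '' A) ≤ μH[(d : ℝ)] (F '' (A ∩ S)) + μH[(d : ℝ)] (F '' (A ∩ T)) := by
            conv_lhs => rw [hu, image_union]
            exact measure_union_le _ _
        _ ≤ _ := add_le_add
            (hS.2.trans (mul_le_mul_right (measure_mono inter_subset_left) _))
            (hT.2.trans (mul_le_mul_right (measure_mono inter_subset_left) _))
  · intro q hq
    obtain ⟨V, hV, C, hC, h⟩ := exists_riemannianVolume_le_volume (d := d) q
    obtain ⟨W, hW, C', hC', h'⟩ := hF.exists_volume_image_le hq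
    -- In `ℝᵈ`, Lebesgue and `d`-dimensional Hausdorff measure are both Haar measures, so they
    -- differ by a nonzero finite factor.
    have hvol := Measure.isAddLeftInvariant_eq_smul
      (volume : Measure (EuclideanSpace ℝ (Fin d))) μH[(d : ℝ)]
    have hne := Measure.addHaarScalarFactor_volume_hausdorffMeasure_ne_zero d
    set a := Measure.addHaarScalarFactor (volume : Measure (EuclideanSpace ℝ (Fin d))) μH[(d : ℝ)]
    have hva : ∀ S : Set (EuclideanSpace ℝ (Fin d)), volume S = (a : ℝ≥0∞) * μH[(d : ℝ)] S := by
      intro S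
      rw [hvol]
      rfl
    have ha0 : (a : ℝ≥0∞) ≠ 0 := by simpa using hne
    refine ⟨V ∩ W, nhdsWithin_le_nhds (inter_mem hV hW),
      max (C * a * C') (C' * (a : ℝ≥0∞)⁻¹ * C), ?_, fun A hA => ⟨?_, ?_⟩⟩
    · have h1 : C * a * C' ≠ ⊤ := ENNReal.mul_ne_top (ENNReal.mul_ne_top hC (by simp)) hC'
      have h2 : C' * (a : ℝ≥0∞)⁻¹ * C ≠ ⊤ :=
        ENNReal.mul_ne_top (ENNReal.mul_ne_top hC' (ENNReal.inv_ne_top.2 ha0)) hC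
      exact max_ne_top h1 h2
    · calc riemannianVolume d M A
          ≤ C * volume (chartAt (EuclideanSpace ℝ (Fin d)) q '' A) :=
            (h A (hA.trans inter_subset_left)).1
        _ = C * a * μH[(d : ℝ)] (chartAt (EuclideanSpace ℝ (Fin d)) q '' A) := by
            rw [hva, mul_assoc]
        _ ≤ C * a * (C' * μH[(d : ℝ)] (F '' A)) :=
            mul_le_mul_right (h' A (hA.trans inter_subset_right)).2 _
        _ = C * a * C' * μH[(d : ℝ)] (F '' A) := by rw [mul_assoc (C * a)]
        _ ≤ _ := mul_le_mul_left (le_max_left _ _) _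
    · calc μH[(d : ℝ)] (F '' A)
          ≤ C' * μH[(d : ℝ)] (chartAt (EuclideanSpace ℝ (Fin d)) q '' A) :=
            (h' A (hA.trans inter_subset_right)).1
        _ = C' * (a : ℝ≥0∞)⁻¹ * volume (chartAt (EuclideanSpace ℝ (Fin d)) q '' A) := by
            rw [hva, mul_assoc, ← mul_assoc (a : ℝ≥0∞)⁻¹, ENNReal.inv_mul_cancel ha0 (by simp),
              one_mul]
        _ ≤ C' * (a : ℝ≥0∞)⁻¹ * (C * riemannianVolume d M A) :=
            mul_le_mul_right (h A (hA.trans inter_subset_left)).2 _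
        _ = C' * (a : ℝ≥0∞)⁻¹ * C * riemannianVolume d M A := by rw [mul_assoc (C' * _)]
        _ ≤ _ := mul_le_mul_left (le_max_right _ _) _

end Comparison

open scoped MeasureTheory.Measure in
-- The hypothesis makes `q` constant on the fibers of `p` in `A`, so on `A` it factors through `p`
-- by a `K`-Lipschitz map, obtained from a chosen section of `p`.
theorem hausdorffMeasure_image_le_of_edist_le {α X Y : Type*} [EMetricSpace X]
    [MeasurableSpace X] [BorelSpace X] [EMetricSpace Y] [MeasurableSpace Y] [BorelSpace Y]
    {p : α → X} {q : α → Y} {A : Set α} {K : NNReal}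
    (h : ∀ x ∈ A, ∀ y ∈ A, edist (q x) (q y) ≤ K * edist (p x) (p y)) {s : ℝ} (hs : 0 ≤ s) :
    μH[s] (q '' A) ≤ (K : ℝ≥0∞) ^ s * μH[s] (p '' A) := by
  obtain rfl | ⟨⟨a, -⟩⟩ := A.eq_empty_or_nonempty
  · simp
  have : Nonempty α := ⟨a⟩
  have hmem : ∀ x ∈ A, Function.invFunOn p A (p x) ∈ A ∧ p (Function.invFunOn p A (p x)) = p x :=
    fun x hx => ⟨Function.invFunOn_mem ⟨x, hx, rfl⟩, Function.invFunOn_eq ⟨x, hx, rfl⟩⟩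
  have hL : LipschitzOnWith K (q ∘ Function.invFunOn p A) (p '' A) := by
    rintro _ ⟨x, hx, rfl⟩ _ ⟨y, hy, rfl⟩
    have := h _ (hmem x hx).1 _ (hmem y hy).1
    rwa [(hmem x hx).2, (hmem y hy).2] at this
  have himg : q '' A = (q ∘ Function.invFunOn p A) '' (p '' A) := by
    rw [image_image]
    refine image_congr fun x hx => ?_
    have := h x hx _ (hmem x hx).1
    rw [(hmem x hx).2, edist_self, mul_zero, nonpos_iff_eq_zero, edist_eq_zero] at this
    exact this
  rw [himg]
  exact hL.hausdorffMeasure_image_le hs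

/-- Infima of nonempty families in `ℕ∞` are attained, and a value other than `⊤` rules out the empty
family. -/
theorem exists_isSpanning_encard_eq_rInv {d m : ℕ} {M : Type*} [MetricSpace M]
    [ChartedSpace (EuclideanSpace ℝ (Fin d)) M]
    {f₀ : (x : M) → TangentSpace (𝓡 d) x} {f : Fin m → (x : M) → TangentSpace (𝓡 d) x}
    {U : Set (EuclideanSpace ℝ (Fin m))} {τ : ℝ} {K Q : Set M}
    (h : rInv f₀ f U τ K Q ≠ ⊤) :
    ∃ S : Set (Control U), IsSpanning f₀ f τ K Q S ∧ S.encard = rInv f₀ f U τ K Q := by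
  rw [rInv, iInf_subtype'] at h ⊢
  have : Nonempty {S : Set (Control U) // IsSpanning f₀ f τ K Q S} := by
    by_contra hne
    rw [not_nonempty_iff] at hne
    exact h (iInf_of_empty _)
  obtain ⟨⟨S, hS⟩, hSe⟩ := ciInf_mem
    (fun S : {S : Set (Control U) // IsSpanning f₀ f τ K Q S} => S.1.encard)
  exact ⟨S, hS, hSe⟩

/-! ### Volume of `K` bounded by spanning numbers and tube volumes -/

section Bound

variable {d m : ℕ} {M : Type*} [MetricSpace M] [MeasurableSpace M] [BorelSpace M]
  [ChartedSpace (EuclideanSpace ℝ (Fin d)) M] [IsManifold (𝓡 d) ∞ M]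
  [Bundle.RiemannianBundle (fun x : M => TangentSpace (𝓡 d) x)]
  [IsContMDiffRiemannianBundle (𝓡 d) ∞ (EuclideanSpace ℝ (Fin d))
      (fun x : M => TangentSpace (𝓡 d) x)]
  [IsRiemannianManifold (𝓡 d) M]
  {f₀ : (x : M) → TangentSpace (𝓡 d) x} {f : Fin m → (x : M) → TangentSpace (𝓡 d) x}
  {U : Set (EuclideanSpace ℝ (Fin m))}

omit [IsRiemannianManifold (𝓡 d) M] in
/-- Flowing for a bounded time inside a compact set distorts the volume by a bounded factor. -/
theorem IsEmbeddingNear.exists_riemannianVolume_le_image_flow {E : Type*} [NormedAddCommGroup E]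
    [NormedSpace ℝ E] [CompleteSpace E] [MeasurableSpace E] [BorelSpace E] {F : M → E} {Q : Set M}
    (hQ : IsCompact Q)
    (hF : IsEmbeddingNear d Q F) (hc : IsComplete f₀ f U)
    (hf₀ : ContMDiff (𝓡 d) (𝓡 d).tangent 2 (fun x => (⟨x, f₀ x⟩ : TangentBundle (𝓡 d) M)))
    (hf : ∀ i, ContMDiff (𝓡 d) (𝓡 d).tangent 2
      (fun x => (⟨x, f i x⟩ : TangentBundle (𝓡 d) M)))
    (hU : IsCompact U) {T : ℝ} (hT : 0 ≤ T) :
    ∃ C : ℝ≥0∞, C ≠ ⊤ ∧ ∀ (u : Control U) (A : Set M),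
      (∀ x ∈ A, ∀ t ∈ Icc 0 T, flow f₀ f t x u ∈ Q) →
      riemannianVolume d M A ≤ C * riemannianVolume d M ((fun x => flow f₀ f T x u) '' A) := by
  obtain ⟨C, hC, hCA⟩ := hF.exists_riemannianVolume_le hQ
  obtain ⟨L, hL, hexp⟩ := hF.exists_norm_sub_le_exp hQ hf₀ hf hU
  set K : NNReal := Real.toNNReal (Real.exp (L * T))
  have hd : (0 : ℝ) ≤ d := d.cast_nonneg
  refine ⟨C * ((K : ℝ≥0∞) ^ (d : ℝ) * C), ENNReal.mul_ne_top hC (ENNReal.mul_ne_top (by simp) hC),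
    fun u A hA => ?_⟩
  have h0 : ∀ x, flow f₀ f 0 x u = x := fun x => (isTrajectory_flow hc x u).2
  have hAQ : A ⊆ Q := fun x hx => h0 x ▸ hA x hx 0 ⟨le_rfl, hT⟩
  have hBQ : (fun x => flow f₀ f T x u) '' A ⊆ Q := by
    rintro _ ⟨x, hx, rfl⟩
    exact hA x hx T ⟨hT, le_rfl⟩
  -- Grönwall run from time `T` back to `0`: initial points are no farther apart than `e^{LT}` times
  -- the final ones, measured through `F`.
  have hle : ∀ x ∈ A, ∀ y ∈ A, edist (F x) (F y) ≤
      K * edist (F (flow f₀ f T x u)) (F (flow f₀ f T y u)) := by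
    intro x hx y hy
    have := hexp u _ _ (isTrajectory_flow hc x u).1 (isTrajectory_flow hc y u).1 T 0
      (by rw [uIcc_of_ge hT]; exact hA x hx) (by rw [uIcc_of_ge hT]; exact hA y hy)
    simp only [h0, zero_sub, abs_neg, abs_of_nonneg hT] at this
    rw [edist_dist, edist_dist, dist_eq_norm, dist_eq_norm, mul_comm]
    refine (ENNReal.ofReal_le_ofReal this).trans ?_
    rw [ENNReal.ofReal_mul (norm_nonneg _)]
    exact le_rfl
  have := hausdorffMeasure_image_le_of_edist_le
    (p := fun x => F (flow f₀ f T x u)) (q := F) hle hd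
  refine (hCA A hAQ).1.trans ?_
  rw [mul_assoc C]
  refine mul_le_mul_right (this.trans ?_) _
  rw [mul_assoc, ← image_image F]
  exact mul_le_mul_right (hCA _ hBQ).2 _

/-- The volume of `K` is controlled by the number of controls needed to keep `K` in `Q`, times the
largest volume of a fiber tube. -/
theorem exists_riemannianVolume_le_rInv_mul (hc : IsComplete f₀ f U)
    (hf₀ : ContMDiff (𝓡 d) (𝓡 d).tangent 2 (fun x => (⟨x, f₀ x⟩ : TangentBundle (𝓡 d) M)))
    (hf : ∀ i, ContMDiff (𝓡 d) (𝓡 d).tangent 2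
      (fun x => (⟨x, f i x⟩ : TangentBundle (𝓡 d) M)))
    (hU : IsCompact U) (hconv : Convex ℝ U) {Q : Set M} (hQ : IsCompact Q)
    (hP3 : LowerHemicontinuous (fun u : Control U => fiber f₀ f Q u)) {ε : ℝ} (hε : 0 < ε) :
    ∃ T : ℝ, 0 ≤ T ∧ ∃ C : ℝ≥0∞, C ≠ ⊤ ∧ ∀ (K : Set M) (t : ℝ) (b : ℝ≥0∞), 0 ≤ t →
      rInv f₀ f U (t + 2 * T) K Q ≠ ⊤ →
      (∀ u : Control U, riemannianVolume d M (fiberTube f₀ f Q t u ε) ≤ b) →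
      riemannianVolume d M K ≤ (rInv f₀ f U (t + 2 * T) K Q : ℝ≥0∞) * (C * b) := by
  obtain ⟨T, hT, hTube⟩ := exists_flow_mem_fiberTube hc hf₀ hf hU hconv hQ hP3 hε
  obtain ⟨s, F, hF⟩ := exists_isEmbeddingNear (d := d) hQ
  obtain ⟨C, hC, hvol⟩ := hF.exists_riemannianVolume_le_image_flow hQ hc hf₀ hf hU hT
  refine ⟨T, hT, C, hC, fun K t b ht hr hb => ?_⟩
  obtain ⟨S, hS, hSr⟩ := exists_isSpanning_encard_eq_rInv hr
  rw [← hSr] at hr ⊢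
  have hfin : S.Finite := encard_ne_top_iff.1 hr
  set A : Control U → Set M := fun u => {x | ∀ s ∈ Icc 0 (t + 2 * T), flow f₀ f s x u ∈ Q}
  have hA : ∀ u, riemannianVolume d M (A u) ≤ C * b := by
    intro u
    refine (hvol u (A u) fun x hx s hs => hx s ⟨hs.1, by linarith [hs.2]⟩).trans
      (mul_le_mul_right ((measure_mono ?_).trans (hb (u.shift T))) _)
    rintro _ ⟨x, hx, rfl⟩
    exact hTube u x t hx
  calc riemannianVolume d M K ≤ riemannianVolume d M (⋃ u ∈ S, A u) := by
        refine measure_mono fun x hx => ?_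
        obtain ⟨u, hu, h⟩ := hS x hx
        exact mem_biUnion hu h
    _ ≤ ∑' u : S, riemannianVolume d M (A u) := measure_biUnion_le _ hfin.countable _
    _ ≤ ∑' _ : S, C * b := ENNReal.tsum_le_tsum fun u => hA u
    _ = (S.encard : ℝ≥0∞) * (C * b) := by
        rw [ENNReal.tsum_const]
        rfl

end Bound

/-! ### Passage to exponential growth rates -/

theorem le_ofReal_exp_of_lt_mul_log {t c : ℝ} (ht : 0 < t) {v : ℝ≥0∞}
    (h : (c : EReal) < ((-(1 / t) : ℝ) : EReal) * ENNReal.log v) :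
    v ≤ ENNReal.ofReal (Real.exp (-(t * c))) := by
  rw [← ENNReal.exp_log v, ← EReal.exp_coe]
  refine EReal.exp_monotone ?_
  have hneg : -(1 / t) < 0 := by simpa using ht
  induction hy : ENNReal.log v with
  | bot => exact bot_le
  | top =>
    -- Infinite volume would make the right side of `h` equal to `⊥`, so the hypothesis excludes it.
    rw [hy, EReal.coe_mul_top_of_neg hneg] at h
    exact absurd h not_lt_bot
  | coe r =>
    rw [hy, ← EReal.coe_mul, EReal.coe_lt_coe_iff] at h
    rw [EReal.coe_le_coe_iff]
    have : t * c < t * (-(1 / t) * r) := mul_lt_mul_of_pos_left h ht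
    have h2 : t * (-(1 / t) * r) = -r := by field_simp
    linarith

theorem le_mul_log_of_mul_le {τ c : ℝ} (hτ : 0 < τ) {r : ℝ≥0∞}
    (h : ENNReal.ofReal (Real.exp (τ * c)) ≤ r) :
    (c : EReal) ≤ ((1 / τ : ℝ) : EReal) * ENNReal.log r := by
  have hpos : (0 : ℝ) < 1 / τ := by positivity
  have h1 : ((τ * c : ℝ) : EReal) ≤ ENNReal.log r := by
    rw [← EReal.exp_coe] at h
    rw [← EReal.log_exp ((τ * c : ℝ) : EReal)]
    exact ENNReal.log_monotone h
  calc (c : EReal) = ((1 / τ : ℝ) : EReal) * ((τ * c : ℝ) : EReal) := by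
        rw [← EReal.coe_mul]
        congr 1
        field_simp
    _ ≤ _ := mul_le_mul_of_nonneg_left h1 (by exact_mod_cast hpos.le)

end InvarianceEntropy
end

open InvarianceEntropy in
theorem mainTheorem4 {d m : ℕ} {M : Type*}
    [MetricSpace M] [ConnectedSpace M] [MeasurableSpace M] [BorelSpace M]
    [ChartedSpace (EuclideanSpace ℝ (Fin d)) M] [IsManifold (𝓡 d) ∞ M]
    [Bundle.RiemannianBundle (fun x : M => TangentSpace (𝓡 d) x)]
    [IsContMDiffRiemannianBundle (𝓡 d) ∞ (EuclideanSpace ℝ (Fin d))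
      (fun x : M => TangentSpace (𝓡 d) x)]
    [IsRiemannianManifold (𝓡 d) M]
    (f₀ : (x : M) → TangentSpace (𝓡 d) x) (f : Fin m → (x : M) → TangentSpace (𝓡 d) x)
    (hf₀ : ContMDiff (𝓡 d) (𝓡 d).tangent 2
      (fun x => (⟨x, f₀ x⟩ : TangentBundle (𝓡 d) M)))
    (hf : ∀ i, ContMDiff (𝓡 d) (𝓡 d).tangent 2
      (fun x => (⟨x, f i x⟩ : TangentBundle (𝓡 d) M)))
    (U : Set (EuclideanSpace ℝ (Fin m)))
    (hU_inf : U.Infinite) (hU_compact : IsCompact U) (hU_convex : Convex ℝ U)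
    (hcomplete : InvarianceEntropy.IsComplete f₀ f U)
    (Q : Set M) (hQ : IsCompact Q)
    (hP3 : LowerHemicontinuous (fun u : Control U => fiber f₀ f Q u))
    (K : Set M) (hKQ : K ⊆ Q) (hK : IsCompact K)
    (hK_inv : ∀ x ∈ K, ∃ u : Control U, ∀ t : ℝ, 0 ≤ t → flow f₀ f t x u ∈ Q)
    (hK_vol : 0 < riemannianVolume d M K)
    (ε : ℝ) (hε : 0 < ε) :
    limsup (fun t : ℝ => ⨅ u : Control U,
        ((-(1 / t) : ℝ) : EReal) * ENNReal.log (riemannianVolume d M (fiberTube f₀ f Q t u ε)))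
      atTop ≤ hInv f₀ f U K Q := by
  obtain ⟨T, hT, C, hC, hbound⟩ := exists_riemannianVolume_le_rInv_mul hcomplete hf₀ hf hU_compact
    hU_convex hQ hP3 hε
  refine le_of_forall_lt_imp_le_of_dense fun c' hc' => ?_
  -- Two reals are inserted below the limsup; the gap `c₂ - c` will absorb the extra time `2 * T`
  -- and the constant factor in the volume bound.
  obtain ⟨c, hc'c, hc⟩ := EReal.lt_iff_exists_real_btwn.1 hc'
  obtain ⟨c₂, hcc₂, hc₂⟩ := EReal.lt_iff_exists_real_btwn.1 hc
  rw [EReal.coe_lt_coe_iff] at hcc₂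
  refine hc'c.le.trans (le_limsup_of_frequently_le ?_)
  have hfreq := frequently_lt_of_lt_limsup (by isBoundedDefault) hc₂
  obtain ⟨κ, hκ0, hκ⟩ := ENNReal.lt_iff_exists_real_btwn.1 hK_vol
  have hκpos : 0 < κ := by simpa using hκ.1
  -- The added `1` makes the constant positive, so that `log (κ / C₁)` is meaningful.
  set C₁ := C.toReal + 1
  have hC₁ : 0 < C₁ := by positivity
  have hCC₁ : C ≤ ENNReal.ofReal C₁ := by
    rw [← ENNReal.ofReal_toReal hC]
    exact ENNReal.ofReal_le_ofReal (by simp [C₁])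
  set D := Real.log (κ / C₁)
  -- A rearrangement of `(t + 2 * T) * c ≤ D + t * c₂`, the comparison of exponents needed at the
  -- end.
  have hlarge : ∀ᶠ t : ℝ in atTop, 2 * T * c - D ≤ t * (c₂ - c) :=
    (tendsto_id.atTop_mul_const (sub_pos.2 hcc₂)).eventually_ge_atTop _
  -- The entropy is evaluated at the times `t + 2 * T`, for the arbitrarily large `t` at which all
  -- tubes are small.
  refine (tendsto_atTop_add_const_right atTop (2 * T) tendsto_id).frequently ?_
  refine (hfreq.and_eventually (hlarge.and (eventually_gt_atTop 0))).mono ?_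
  rintro t ⟨ht, htl, ht0⟩
  refine le_mul_log_of_mul_le (by simp only [id]; positivity) ?_
  by_cases hr : rInv f₀ f U (t + 2 * T) K Q = ⊤
  · simp [hr]
  have htube : ∀ u : Control U, riemannianVolume d M (fiberTube f₀ f Q t u ε) ≤
      ENNReal.ofReal (Real.exp (-(t * c₂))) := fun u =>
    le_ofReal_exp_of_lt_mul_log ht0 (ht.trans_le (iInf_le _ u))
  have hkey := hκ.2.le.trans (hbound K t _ ht0.le hr htube)
  set r := rInv f₀ f U (t + 2 * T) K Q
  have hpos : 0 < C₁ * Real.exp (-(t * c₂)) := by positivity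
  have h1 : ENNReal.ofReal κ ≤ (r : ℝ≥0∞) * ENNReal.ofReal (C₁ * Real.exp (-(t * c₂))) := by
    refine hkey.trans (mul_le_mul_right ?_ _)
    rw [ENNReal.ofReal_mul hC₁.le]
    exact mul_le_mul_left hCC₁ _
  rw [← ENNReal.div_le_iff_le_mul (by simp [hpos]) (by simp), ← ENNReal.ofReal_div_of_pos hpos] at h1
  refine (ENNReal.ofReal_le_ofReal ?_).trans h1
  have h2 : κ / (C₁ * Real.exp (-(t * c₂))) = Real.exp (D + t * c₂) := by
    rw [Real.exp_add, Real.exp_log (by positivity), Real.exp_neg]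
    field_simp
  rw [h2]
  refine Real.exp_le_exp.2 ?_
  simp only [id]
  linarith
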